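/- **Setting.** Orders arrive at a restaurant in a Poisson process of rate $1$ and are prepared one at a time, first come first served, with independent exponential preparation times of rate $\mu$. A prepared order waits until a rider fetches it; an arriving rider takes the earliest prepared order, or waits if there is none, and an order that becomes ready is taken by the earliest waiting rider. Let $Q_1$ be the number of orders not yet prepared, and let $Q_2$ be the number of prepared orders waiting for a rider, or minus the number of waiting riders. For a disclosure threshold $M\in\{0,1,2,\dots\}\cup\{\infty\}$ the signal is $\theta=\max(Q_2-M,0)$ (with $\theta\equiv 0$ if $M=\infty$). A policy consists of dispatch rates $\vec\lambda=(\lambda_0,\lambda_1,\dots)$ and a buffer length $d\in\{0,1,2,\dots\}$: riders arrive at rate $\lambda_\theta$ while $Q_2>-d$, and no rider is sent while $Q_2=-d$. Thus $(Q_1,Q_2)$ is a continuous-time Markov chain, which we start from the empty system. Rates $\vec\lambda$ are called admissible (for given $\mu$ and maximal rate $\Lambda$) if $\mu,\Lambda,\lambda_0>1$, $\lambda_i>0$ for all $i>0$, $\lambda_i\le\Lambda$ for all $i$, and $\sum_{i\ge1}\prod_{j=1}^{i}\frac1{\lambda_j}<\infty$. Denote by $\mathbb E_{\vec\lambda,d,M}[T_o]\in[0,\infty]$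 and $\mathbb E_{\vec\lambda,d,M}[T_r]\in[0,\infty]$ the mean order and rider waiting times, i.e. the almost sure limits, as $n\to\infty$, of the average time from arrival until being fetched over the first $n$ orders, respectively of the average time from arrival until fetching an order over the first $n$ riders. **Theorem.** Let $\vec\lambda$ be admissible, $d\in\{0,1,2,\dots\}$, $M\in\{1,2,\dots\}\cup\{\infty\}$ and let $m$ be an integer with $0\le m<M$. Put $\rho=1/\lambda_0$ and $$C=\frac{\rho-\rho^{M-m+1}}{1-\rho}+\rho^{M-m}\sum_{i=M+1}^{\infty}\prod_{j=1}^{i-M}\frac1{\lambda_j}$$ (read as $C=\frac{\rho}{1-\rho}$ if $M=\infty$), and define $$\tau_0=\lambda_0,\qquad \tau_1=\frac{1}{(1-\frac1\Lambda)\,C},\qquad \tau_i=\Lambda\quad (i>1).$$ Then $\vec\tau=(\tau_0,\tau_1,\dots)$ is admissible, the mean waiting times of both systems exist (as almost sure limits that are constants in $[0,\infty]$), and $$\mathbb E_{\vec\tau,d,m}[T_o]\le \mathbb E_{\vec\lambda,d,M}[T_o],\qquad \mathbb E_{\vec\tau,d,m}[T_r]=\mathbb E_{\vec\lambda,d,M}[T_r].$$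 Equality holds in the first relation only if $$\rho=\frac{\Lambda-1}{\Lambda}\left(\frac{\rho-\rho^{M-m+1}}{1-\rho}+\rho^{M-m}\sum_{i=M+1}^{\infty}\prod_{j=1}^{i-M}\frac1{\lambda_j}\right),$$ the bracket being read as $\frac{\rho}{1-\rho}$ if $M=\infty$. -/

import Mathlib

open MeasureTheory ProbabilityTheory Filter Topology
open scoped ENNReal

noncomputable section

namespace MealDelivery

/-- A dispatch policy together with the disclosure threshold it is used under: the rates
`rate i` at which riders are dispatched while the signal equals `i`, the buffer length `d`
(the maximal number of waiting riders) and the threshold `M`; `M = ⊤` means that the restaurant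
discloses nothing. -/
structure Policy where
  rate : ℕ → ℝ
  buffer : ℕ
  threshold : ℕ∞

/-- The signal `θ`: it is `0` if `q ≤ M` and `q - M` if `q > M`; it is constantly `0` if `M = ⊤`. -/
def signal (M : ℕ∞) (q : ℤ) : ℕ :=
  if M = ⊤ then 0 else (q - (M.toNat : ℤ)).toNat

/-- The standing assumptions on the preparation rate `μ`, the maximal dispatch rate `Λ` and the
dispatch rates of a policy. -/
structure Policy.Admissible (μ Λ : ℝ) (P : Policy) : Prop where
  one_lt_prep : 1 < μ
  one_lt_max : 1 < Λ
  one_lt_rate_zero : 1 < P.rate 0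
  rate_pos : ∀ i, 0 < i → 0 < P.rate i
  rate_le : ∀ i, P.rate i ≤ Λ
  summable : Summable fun i : ℕ => ∏ j ∈ Finset.Icc 1 (i + 1), 1 / P.rate j

/-- Cumulative counts: orders placed, orders whose preparation is finished, riders arrived. -/
structure Counts where
  ordered : ℕ
  prepared : ℕ
  riders : ℕ

/-- `Q₁`: the number of orders in the processing queue. -/
def Counts.q₁ (x : Counts) : ℕ := x.ordered - x.prepared

/-- `Q₂`: the number of prepared orders that wait for a rider, or minus the number of riders that
wait for an order. -/
def Counts.q₂ (x : Counts) : ℤ := (x.prepared : ℤ) - (x.riders : ℤ)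

/-- The rate at which a preparation is finished. -/
def prepRate (μ : ℝ) (x : Counts) : ℝ := if 0 < x.q₁ then μ else 0

/-- The rate at which riders arrive; no rider is sent while `d` riders are waiting. -/
def riderRate (P : Policy) (x : Counts) : ℝ :=
  if -(P.buffer : ℤ) < x.q₂ then P.rate (signal P.threshold x.q₂) else 0

/-- The total jump rate; orders arrive at rate `1`. -/
def totalRate (μ : ℝ) (P : Policy) (x : Counts) : ℝ := 1 + prepRate μ x + riderRate P x

/-- The jump of the Markov chain: for `u` uniform on `[0, 1]`, the next event is an order arrival,
the end of a preparation or a rider arrival with probabilities proportional to the rates. -/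
def step (μ : ℝ) (P : Policy) (x : Counts) (u : ℝ) : Counts :=
  if u * totalRate μ P x < 1 then { x with ordered := x.ordered + 1 }
  else if u * totalRate μ P x < 1 + prepRate μ x then { x with prepared := x.prepared + 1 }
  else { x with riders := x.riders + 1 }

/-- The randomness: for each jump, a standard exponential and a uniform variable. -/
abbrev Noise : Type := ℕ → ℝ × unitInterval

instance : IsProbabilityMeasure (expMeasure 1) := isProbabilityMeasure_expMeasure one_pos

/-- All the exponential and uniform variables are independent. -/
def noiseMeasure : Measure Noise :=
  Measure.infinitePi fun _ : ℕ => (expMeasure 1).prod (volume : Measure unitInterval)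

/-- The counts after `n` jumps, for a system that starts empty. -/
def counts (μ : ℝ) (P : Policy) (ω : Noise) : ℕ → Counts
  | 0 => ⟨0, 0, 0⟩
  | n + 1 => step μ P (counts μ P ω n) (ω n).2

/-- The time of the `n`-th jump: the holding time in the state `x` is exponential with rate
`totalRate μ P x`. -/
def jumpTime (μ : ℝ) (P : Policy) (ω : Noise) (n : ℕ) : ℝ :=
  ∑ k ∈ Finset.range n, (ω k).1 / totalRate μ P (counts μ P ω k)

/-- The first time at which the count `f` exceeds `k`, `⊤` if this never happens. -/
def timeOf (μ : ℝ) (P : Policy) (ω : Noise) (f : Counts → ℕ) (k : ℕ) : ℝ≥0∞ :=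
  ⨅ (n : ℕ) (_ : k < f (counts μ P ω n)), ENNReal.ofReal (jumpTime μ P ω n)

/-- The time at which the order number `k` (counted from `0`) is fetched. Orders are prepared
first come first served, a rider takes the earliest prepared order, and a prepared order is given
to the earliest waiting rider, so that the order number `k` is fetched by the rider number `k`,
as soon as it is prepared and this rider is there. -/
def fetchTime (μ : ℝ) (P : Policy) (ω : Noise) (k : ℕ) : ℝ≥0∞ :=
  max (timeOf μ P ω Counts.prepared k) (timeOf μ P ω Counts.riders k)

/-- The waiting time of the order number `k`: from its arrival until it is fetched. -/
def orderWait (μ : ℝ) (P : Policy) (ω : Noise) (k : ℕ) : ℝ≥0∞ :=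
  fetchTime μ P ω k - timeOf μ P ω Counts.ordered k

/-- The waiting time of the rider number `k`: from their arrival until they fetch an order. -/
def riderWait (μ : ℝ) (P : Policy) (ω : Noise) (k : ℕ) : ℝ≥0∞ :=
  fetchTime μ P ω k - timeOf μ P ω Counts.riders k

/-- `t` is the mean order waiting time: almost surely, the waiting times of the first `n` orders
have averages that tend to `t`. -/
def IsMeanOrderWait (μ : ℝ) (P : Policy) (t : ℝ≥0∞) : Prop :=
  ∀ᵐ ω ∂noiseMeasure,
    Tendsto (fun n : ℕ => (∑ k ∈ Finset.range n, orderWait μ P ω k) / (n : ℝ≥0∞)) atTop (𝓝 t)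

/-- `t` is the mean rider waiting time: almost surely, the waiting times of the first `n` riders
have averages that tend to `t`. -/
def IsMeanRiderWait (μ : ℝ) (P : Policy) (t : ℝ≥0∞) : Prop :=
  ∀ᵐ ω ∂noiseMeasure,
    Tendsto (fun n : ℕ => (∑ k ∈ Finset.range n, riderWait μ P ω k) / (n : ℝ≥0∞)) atTop (𝓝 t)

/-- The constant `C` of the improvement algorithm, where `ρ = 1 / λ₀`; the index `i` of the sum
stands for `i + M + 1`. For `M = ⊤` the powers `ρ ^ (M - m)` and `ρ ^ (M - m + 1)` are `0`. -/
def improveConst (P : Policy) (m : ℕ) : ℝ :=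
  let ρ : ℝ := 1 / P.rate 0
  if P.threshold = ⊤ then ρ / (1 - ρ)
  else
    let M : ℕ := P.threshold.toNat
    (ρ - ρ ^ (M - m + 1)) / (1 - ρ)
      + ρ ^ (M - m) * ∑' i : ℕ, ∏ j ∈ Finset.Icc 1 (i + 1), 1 / P.rate j

/-- The improvement algorithm: the new policy for the lower threshold `m`, with rates
`τ₀ = λ₀`, `τ₁ = 1 / ((1 - 1 / Λ) C)`, `τᵢ = Λ` for `i > 1` and with the same buffer. -/
def improve (Λ : ℝ) (P : Policy) (m : ℕ) : Policy where
  rate i :=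
    if i = 0 then P.rate 0
    else if i = 1 then 1 / ((1 - 1 / Λ) * improveConst P m)
    else Λ
  buffer := P.buffer
  threshold := (m : ℕ∞)

end MealDelivery

end

open MealDelivery

/-! The jump chain of `(Q₁, Q₂)` is a positive recurrent tandem queue with product form. The weight
of `(a, q)` is `μ⁻ᵃ` times `weight P q`, and moving from `q` to `q + 1` (for `q ≥ -d`) multiplies
`weight` by the inverse of the dispatch rate at `q + 1` (`jumpStationary_invariant`). Little's law
identifies the mean waiting times with stationary means: of `Q₁ + Q₂⁺` for orders, and of `Q₂⁻` for
riders (`isMeanOrderWait`, `isMeanRiderWait`). It is proved pathwise over the cycles between visits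
to the empty system, which are i.i.d. The strong law for `[0, ∞]`-valued variables covers infinite
means.

It remains to compare the weights of the two policies. They agree up to `m`, since both signals are
`0` there. The constant `C` is the total weight of the original policy above `m` relative to that of
`m`, and `τ₁` is chosen so that the new policy has the same total weight above `m`
(`tsum_weight_above_improve`). Hence the normalizations agree, and so do the means of `Q₂⁻`, in
which only `q < 0` counts.

Above `m` all rates are at most `Λ`, so the original weights shrink per step at most by the factor
`1/Λ`; the new ones shrink by exactly this factor. Among sequences of equal sum with this property
the geometric one has the smallest tail sums (`tail_le_tail`), hence the smallest mean of `Q₂⁺`. If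
the means are equal, all tail sums coincide, hence so do the weights of `m + 1`. This says `τ₁ =
λ₀`, which is the stated relation for `ρ` (`rate_zero_eq_of_mean_eq`). -/

noncomputable section

namespace Regeneration

/-! ### Past and future of an i.i.d. sequence -/

section Shift

variable {E : Type*}

/-- The sequence `ω` without its first `n` terms. -/
def shift (n : ℕ) (ω : ℕ → E) : ℕ → E := fun k => ω (n + k)

lemma shift_shift (m n : ℕ) (ω : ℕ → E) : shift m (shift n ω) = shift (n + m) ω := by
  funext k
  simp [shift, add_assoc]

variable [MeasurableSpace E]

/-- The σ-algebra generated by the first `n` terms. -/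
abbrev past (E : Type*) [mE : MeasurableSpace E] (n : ℕ) : MeasurableSpace (ℕ → E) :=
  ⨆ i ∈ Set.Iio n, MeasurableSpace.comap (fun ω : ℕ → E => ω i) mE

lemma past_le (n : ℕ) : past E n ≤ MeasurableSpace.pi :=
  iSup₂_le fun i _ => (measurable_pi_apply i).comap_le

lemma past_mono {m n : ℕ} (h : m ≤ n) : past E m ≤ past E n :=
  biSup_mono fun _ hi => lt_of_lt_of_le hi h

lemma measurable_past_eval {i n : ℕ} (h : i < n) :
    Measurable[past E n] (fun ω : ℕ → E => ω i) := by
  rw [measurable_iff_comap_le]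
  exact le_iSup₂_of_le i h le_rfl

lemma measurable_shift (n : ℕ) : Measurable (shift n : (ℕ → E) → ℕ → E) :=
  measurable_pi_lambda _ fun k => measurable_pi_apply (n + k)

variable (p : Measure E) [IsProbabilityMeasure p]

lemma measurePreserving_shift (n : ℕ) :
    MeasurePreserving (shift n) (Measure.infinitePi fun _ : ℕ => p)
      (Measure.infinitePi fun _ : ℕ => p) :=
  ⟨measurable_shift n,
    Measure.map_infinitePi_infinitePi_of_inj (P := fun _ : ℕ => p) (add_right_injective n)⟩

/-- The two σ-algebras are generated by disjoint sets of coordinates, `i < n` and `i ≥ n`. -/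
lemma indep_past_shift (n : ℕ) :
    Indep (past E n) (MeasurableSpace.comap (shift n) MeasurableSpace.pi)
      (Measure.infinitePi fun _ : ℕ => p) := by
  have h : iIndepFun (fun (i : ℕ) (ω : ℕ → E) => ω i) (Measure.infinitePi fun _ : ℕ => p) :=
    iIndepFun_infinitePi (X := fun _ x => x) fun _ => measurable_id
  have h2 := indep_iSup_of_disjoint (fun i => (measurable_pi_apply i).comap_le) h.iIndep
    (S := Set.Iio n) (T := Set.Ici n) (Set.disjoint_left.2 fun i hi hj => not_lt.2 (Set.mem_Ici.1 hj) (Set.mem_Iio.1 hi))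
  refine indep_of_indep_of_le_right h2 ?_
  rw [← measurable_iff_comap_le]
  refine @measurable_pi_lambda _ _ _ (_) _ _ fun k => ?_
  rw [measurable_iff_comap_le]
  exact le_iSup₂_of_le (f := fun i _ => MeasurableSpace.comap (fun ω : ℕ → E => ω i) _)
    (n + k) (Nat.le_add_right n k) le_rfl

lemma lintegral_mul_shift {n : ℕ} {F G : (ℕ → E) → ℝ≥0∞} (hF : Measurable[past E n] F)
    (hG : Measurable G) :
    ∫⁻ ω, F ω * G (shift n ω) ∂(Measure.infinitePi fun _ : ℕ => p) =
      (∫⁻ ω, F ω ∂(Measure.infinitePi fun _ : ℕ => p)) *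
        ∫⁻ ω, G ω ∂(Measure.infinitePi fun _ : ℕ => p) := by
  rw [lintegral_mul_eq_lintegral_mul_lintegral_of_independent_measurableSpace (past_le n)
    (measurable_shift n).comap_le (indep_past_shift p n) hF
    (g := fun ω => G (shift n ω)) (hG.comp (comap_measurable _)),
    (measurePreserving_shift p n).lintegral_comp hG]

lemma lintegral_mul_eval {n : ℕ} {F : (ℕ → E) → ℝ≥0∞} {g : E → ℝ≥0∞}
    (hF : Measurable[past E n] F) (hg : Measurable g) :
    ∫⁻ ω, F ω * g (ω n) ∂(Measure.infinitePi fun _ : ℕ => p) =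
      (∫⁻ ω, F ω ∂(Measure.infinitePi fun _ : ℕ => p)) * ∫⁻ e, g e ∂p := by
  have h := lintegral_mul_shift p hF (G := fun ω => g (ω 0)) (hg.comp (measurable_pi_apply 0))
  rw [(measurePreserving_eval_infinitePi (fun _ : ℕ => p) 0).lintegral_comp hg] at h
  exact h

end Shift

/-! ### Strong law of large numbers with values in `[0, ∞]` -/

section StrongLaw

variable {Ω : Type*} [MeasurableSpace Ω] {P : Measure Ω}

lemma strong_law_of_lintegral_ne_top (Z : ℕ → Ω → ℝ≥0∞) (hZ : ∀ i, Measurable (Z i))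
    (hind : Pairwise fun i j => IndepFun (Z i) (Z j) P)
    (hid : ∀ i, IdentDistrib (Z i) (Z 0) P P) (hfin : ∫⁻ ω, Z 0 ω ∂P ≠ ∞) :
    ∀ᵐ ω ∂P, Tendsto (fun n : ℕ => (∑ i ∈ Finset.range n, Z i ω) / (n : ℝ≥0∞)) atTop
      (𝓝 (∫⁻ ω, Z 0 ω ∂P)) := by
  have hlt : ∀ᵐ ω ∂P, ∀ i, Z i ω < ∞ := by
    rw [ae_all_iff]
    intro i
    refine ae_lt_top (hZ i) ?_
    rwa [(hid i).lintegral_eq]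
  have h := strong_law_ae_real (μ := P) (fun i ω => (Z i ω).toReal)
    (integrable_toReal_of_lintegral_ne_top (hZ 0).aemeasurable hfin)
    (fun i j hij => (hind hij).comp ENNReal.measurable_toReal ENNReal.measurable_toReal)
    (fun i => (hid i).comp ENNReal.measurable_toReal)
  filter_upwards [h, hlt] with ω h1 h2
  have h0 : ∀ᵐ ω ∂P, Z 0 ω < ∞ := ae_lt_top (hZ 0) hfin
  rw [integral_toReal (hZ 0).aemeasurable h0] at h1
  have h3 := ENNReal.tendsto_ofReal h1
  rw [ENNReal.ofReal_toReal hfin] at h3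
  refine h3.congr' ?_
  filter_upwards [eventually_gt_atTop 0] with n hn
  rw [ENNReal.ofReal_div_of_pos (by exact_mod_cast hn), ENNReal.ofReal_natCast,
    ENNReal.ofReal_sum_of_nonneg fun _ _ => ENNReal.toReal_nonneg]
  simp only [ENNReal.ofReal_toReal (h2 _).ne]

/-- The strong law of large numbers for nonnegative random variables, whose mean may be `∞`. -/
lemma strong_law_ennreal [IsProbabilityMeasure P] (Z : ℕ → Ω → ℝ≥0∞) (hZ : ∀ i, Measurable (Z i))
    (hind : Pairwise fun i j => IndepFun (Z i) (Z j) P)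
    (hid : ∀ i, IdentDistrib (Z i) (Z 0) P P) :
    ∀ᵐ ω ∂P, Tendsto (fun n : ℕ => (∑ i ∈ Finset.range n, Z i ω) / (n : ℝ≥0∞)) atTop
      (𝓝 (∫⁻ ω, Z 0 ω ∂P)) := by
  by_cases hfin : ∫⁻ ω, Z 0 ω ∂P = ∞
  swap
  · exact strong_law_of_lintegral_ne_top Z hZ hind hid hfin
  have hm : ∀ K : ℕ, Measurable fun z : ℝ≥0∞ => min z (K : ℝ≥0∞) :=
    fun K => measurable_id.min measurable_const
  have h1 : ∀ᵐ ω ∂P, ∀ K : ℕ, Tendsto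
      (fun n : ℕ => (∑ i ∈ Finset.range n, min (Z i ω) (K : ℝ≥0∞)) / (n : ℝ≥0∞)) atTop
      (𝓝 (∫⁻ ω, min (Z 0 ω) (K : ℝ≥0∞) ∂P)) := by
    rw [ae_all_iff]
    intro K
    refine strong_law_of_lintegral_ne_top (fun i ω => min (Z i ω) (K : ℝ≥0∞))
      (fun i => (hm K).comp (hZ i)) (fun i j hij => (hind hij).comp (hm K) (hm K))
      (fun i => (hid i).comp (hm K)) ?_
    refine ((lintegral_mono fun ω => min_le_right _ _).trans_lt (b := ∫⁻ _, (K : ℝ≥0∞) ∂P) ?_).ne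
    simp
  -- By monotone convergence the means of the truncations at `K` are unbounded. The averages of `Z`
  -- dominate those of each truncation, so they exceed every bound eventually.
  have h2 : ⨆ K : ℕ, ∫⁻ ω, min (Z 0 ω) (K : ℝ≥0∞) ∂P = ∞ := by
    rw [← lintegral_iSup (f := fun (K : ℕ) ω => min (Z 0 ω) (K : ℝ≥0∞))
      (fun K => (hm K).comp (hZ 0))
      (fun K L hKL ω => min_le_min le_rfl (by exact_mod_cast hKL)), ← hfin]
    congr 1
    funext ω
    rw [← inf_iSup_eq, ENNReal.iSup_natCast]
    simp
  filter_upwards [h1] with ω h1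
  rw [hfin, ENNReal.tendsto_nhds_top_iff_nat]
  intro N
  obtain ⟨K, hK⟩ := lt_iSup_iff.1 (h2.symm ▸ ENNReal.natCast_lt_top N :
    (N : ℝ≥0∞) < ⨆ K : ℕ, ∫⁻ ω, min (Z 0 ω) (K : ℝ≥0∞) ∂P)
  filter_upwards [(h1 K).eventually (lt_mem_nhds hK)] with n hn
  refine hn.trans_le ?_
  gcongr
  exact min_le_left _ _

end StrongLaw

/-! ### Excursions of a chain driven by noise -/

section Chain

variable {S E : Type*}

/-- The chain that starts at `x₀` and moves by `step`, driven by the noise `ω`. -/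
def chain (step : S → E → S) (x₀ : S) (ω : ℕ → E) : ℕ → S
  | 0 => x₀
  | n + 1 => step (chain step x₀ ω n) (ω n)

variable (step : S → E → S) (x₀ : S)

/-- The chain does not return to `x₀` until time `n` included. -/
def Away (ω : ℕ → E) (n : ℕ) : Prop := ∀ k, 1 ≤ k → k ≤ n → chain step x₀ ω k ≠ x₀

/-- The first return time to `x₀`; `0` if there is none. -/
def returnTime (ω : ℕ → E) : ℕ := sInf {n | 1 ≤ n ∧ chain step x₀ ω n = x₀}

open Classical in
/-- The sum of `G` along the chain over the first cycle. -/
def cycleSum (G : S → E → ℝ≥0∞) (ω : ℕ → E) : ℝ≥0∞ :=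
  ∑' n, if Away step x₀ ω n then G (chain step x₀ ω n) (ω n) else 0

/-- The noise after the first return to `x₀`. -/
def afterReturn (ω : ℕ → E) : ℕ → E := shift (returnTime step x₀ ω) ω

variable {step x₀}

/-- The value `0` is excluded because it encodes the absence of a return, an event that no finite
part of the noise decides. -/
lemma returnTime_eq_iff {ω : ℕ → E} {r : ℕ} (hr : 1 ≤ r) :
    returnTime step x₀ ω = r ↔ chain step x₀ ω r = x₀ ∧ Away step x₀ ω (r - 1) := by
  constructor
  · rintro rfl
    have hne : {n | 1 ≤ n ∧ chain step x₀ ω n = x₀}.Nonempty := by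
      by_contra h
      rw [Set.not_nonempty_iff_eq_empty] at h
      simp [returnTime, h] at hr
    refine ⟨(Nat.sInf_mem hne).2, fun k hk hk2 h => ?_⟩
    have : k < returnTime step x₀ ω := by omega
    exact Nat.notMem_of_lt_sInf this ⟨hk, h⟩
  · rintro ⟨h1, h2⟩
    refine le_antisymm (Nat.sInf_le ⟨hr, h1⟩) (le_csInf ⟨r, hr, h1⟩ ?_)
    rintro k ⟨hk, hk2⟩
    by_contra h
    exact h2 k hk (by omega) hk2

lemma away_iff_lt_returnTime {ω : ℕ → E} (h : returnTime step x₀ ω ≠ 0) (n : ℕ) :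
    Away step x₀ ω n ↔ n < returnTime step x₀ ω := by
  obtain ⟨h1, h2⟩ := (returnTime_eq_iff (step := step) (x₀ := x₀)
    (Nat.one_le_iff_ne_zero.2 h)).1 rfl
  constructor
  · intro hn
    by_contra hlt
    exact hn _ (Nat.one_le_iff_ne_zero.2 h) (not_lt.1 hlt) h1
  · intro hn k hk hk2
    exact h2 k hk (by omega)

lemma away_of_returnTime_eq_zero {ω : ℕ → E} (h : returnTime step x₀ ω = 0) (n : ℕ) :
    Away step x₀ ω n := by
  intro k hk _ hx
  have hne : {n | 1 ≤ n ∧ chain step x₀ ω n = x₀}.Nonempty := ⟨k, hk, hx⟩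
  have := (Nat.sInf_mem hne).1
  rw [returnTime] at h
  omega

lemma chain_shift {ω : ℕ → E} {r : ℕ} (h : chain step x₀ ω r = x₀) (n : ℕ) :
    chain step x₀ (shift r ω) n = chain step x₀ ω (r + n) := by
  induction n with
  | zero => exact h.symm
  | succ n ih => rw [chain, ih]; rfl

lemma cycleSum_eq_sum_range {ω : ℕ → E} (h : returnTime step x₀ ω ≠ 0) (G : S → E → ℝ≥0∞) :
    cycleSum step x₀ G ω =
      ∑ n ∈ Finset.range (returnTime step x₀ ω), G (chain step x₀ ω n) (ω n) := by
  classical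
  rw [cycleSum, tsum_eq_sum (s := Finset.range (returnTime step x₀ ω))]
  · refine Finset.sum_congr rfl fun n hn => ?_
    rw [if_pos ((away_iff_lt_returnTime h n).2 (Finset.mem_range.1 hn))]
  · intro n hn
    rw [if_neg]
    rwa [away_iff_lt_returnTime h, ← Finset.mem_range]

/-- The time of the `j`-th return to `x₀`. -/
def cycleEnd (step : S → E → S) (x₀ : S) (ω : ℕ → E) (j : ℕ) : ℕ :=
  ∑ i ∈ Finset.range j, returnTime step x₀ ((afterReturn step x₀)^[i] ω)

/-- After a return the chain starts afresh from `x₀` with the shifted noise, so iterating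
`afterReturn` enumerates the successive cycles of one trajectory. -/
lemma iterate_afterReturn {ω : ℕ → E}
    (h : ∀ j, returnTime step x₀ ((afterReturn step x₀)^[j] ω) ≠ 0) (j : ℕ) :
    (afterReturn step x₀)^[j] ω = shift (cycleEnd step x₀ ω j) ω ∧
      chain step x₀ ω (cycleEnd step x₀ ω j) = x₀ := by
  induction j with
  | zero => exact ⟨by funext k; simp [cycleEnd, shift], by simp [cycleEnd, chain]⟩
  | succ j ih =>
    have hs : cycleEnd step x₀ ω (j + 1) = cycleEnd step x₀ ω j +
        returnTime step x₀ ((afterReturn step x₀)^[j] ω) := Finset.sum_range_succ _ _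
    constructor
    · rw [Function.iterate_succ_apply', afterReturn, hs, ← shift_shift, ← ih.1]
    · rw [hs, ← chain_shift ih.2, ← ih.1]
      exact ((returnTime_eq_iff (Nat.one_le_iff_ne_zero.2 (h j))).1 rfl).1

lemma sum_cycleSum {ω : ℕ → E}
    (h : ∀ j, returnTime step x₀ ((afterReturn step x₀)^[j] ω) ≠ 0) (G : S → E → ℝ≥0∞) (j : ℕ) :
    ∑ i ∈ Finset.range j, cycleSum step x₀ G ((afterReturn step x₀)^[i] ω) =
      ∑ n ∈ Finset.range (cycleEnd step x₀ ω j), G (chain step x₀ ω n) (ω n) := by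
  induction j with
  | zero => simp [cycleEnd]
  | succ j ih =>
    have hs : cycleEnd step x₀ ω (j + 1) = cycleEnd step x₀ ω j +
        returnTime step x₀ ((afterReturn step x₀)^[j] ω) := Finset.sum_range_succ _ _
    rw [Finset.sum_range_succ, ih, hs, Finset.sum_range_add, cycleSum_eq_sum_range (h j)]
    congr 1
    refine Finset.sum_congr rfl fun n _ => ?_
    rw [(iterate_afterReturn h j).1, chain_shift (iterate_afterReturn h j).2]
    rfl

end Chain

/-! ### Cycles are independent and identically distributed -/

section Cycles

variable {S E : Type*} [Countable S] [MeasurableSpace S] [MeasurableSingletonClass S]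
  [MeasurableSpace E] {step : S → E → S} {x₀ : S}

lemma measurable_uncurry_of_countable {β : Type*} [MeasurableSpace β] {g : S → E → β}
    (hg : ∀ x, Measurable (g x)) : Measurable fun q : S × E => g q.1 q.2 :=
  measurable_from_prod_countable_right hg

lemma measurable_past_chain (hs : ∀ x, Measurable (step x)) {k n : ℕ} (h : k ≤ n) :
    Measurable[past E n] fun ω : ℕ → E => chain step x₀ ω k := by
  induction k with
  | zero => exact @measurable_const _ _ _ (past E n) _
  | succ k ih =>
    exact (measurable_uncurry_of_countable hs).comp
      (Measurable.prodMk (ih (by omega)) (measurable_past_eval (by omega)))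

lemma measurableSet_past_away (hs : ∀ x, Measurable (step x)) (n : ℕ) :
    MeasurableSet[past E n] {ω : ℕ → E | Away step x₀ ω n} := by
  have : {ω : ℕ → E | Away step x₀ ω n} =
      ⋂ k ∈ {k | 1 ≤ k ∧ k ≤ n}, (fun ω : ℕ → E => chain step x₀ ω k) ⁻¹' {x₀}ᶜ := by
    ext ω
    simp [Away]
  rw [this]
  exact MeasurableSet.biInter (Set.to_countable _) fun k hk =>
    measurable_past_chain hs hk.2 (measurableSet_singleton x₀).compl

/-- This is the stopping time property of the return time. -/
lemma measurableSet_past_returnTime (hs : ∀ x, Measurable (step x)) {r : ℕ} (hr : 1 ≤ r) :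
    MeasurableSet[past E r] {ω : ℕ → E | returnTime step x₀ ω = r} := by
  have : {ω : ℕ → E | returnTime step x₀ ω = r} =
      (fun ω : ℕ → E => chain step x₀ ω r) ⁻¹' {x₀} ∩ {ω | Away step x₀ ω (r - 1)} := by
    ext ω
    exact returnTime_eq_iff hr
  rw [this]
  exact MeasurableSet.inter (measurable_past_chain hs le_rfl (measurableSet_singleton x₀))
    (past_mono (by omega) _ (measurableSet_past_away hs _))

lemma measurable_returnTime (hs : ∀ x, Measurable (step x)) :
    Measurable (returnTime step x₀ : (ℕ → E) → ℕ) := by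
  have h1 : ∀ r, 1 ≤ r → MeasurableSet {ω : ℕ → E | returnTime step x₀ ω = r} :=
    fun r hr => past_le _ _ (measurableSet_past_returnTime hs hr)
  refine measurable_to_countable' fun r => ?_
  rcases Nat.eq_zero_or_pos r with rfl | hr
  · have : (returnTime step x₀ : (ℕ → E) → ℕ) ⁻¹' {0} =
        (⋃ r ∈ Set.Ici 1, {ω : ℕ → E | returnTime step x₀ ω = r})ᶜ := by
      ext ω
      simp only [Set.mem_preimage, Set.mem_singleton_iff, Set.mem_compl_iff, Set.mem_iUnion,
        Set.mem_Ici, Set.mem_ofPred_eq, exists_prop, not_exists, not_and]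
      constructor
      · intro h r hr hr2
        omega
      · intro h
        by_contra h0
        exact h _ (Nat.one_le_iff_ne_zero.2 h0) rfl
    rw [this]
    exact (MeasurableSet.biUnion (Set.to_countable _) fun r hr => h1 r hr).compl
  · exact h1 r hr

lemma measurable_afterReturn (hs : ∀ x, Measurable (step x)) :
    Measurable (afterReturn step x₀ : (ℕ → E) → ℕ → E) :=
  (measurable_from_prod_countable_right (f := fun q : ℕ × (ℕ → E) => shift q.1 q.2)
    measurable_shift).comp ((measurable_returnTime hs).prodMk measurable_id)

lemma measurable_past_cycle_term (hs : ∀ x, Measurable (step x)) {G : S → E → ℝ≥0∞}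
    (hG : ∀ x, Measurable (G x)) (n : ℕ) :
    Measurable[past E (n + 1)] fun ω : ℕ → E => G (chain step x₀ ω n) (ω n) :=
  (measurable_uncurry_of_countable hG).comp
    (Measurable.prodMk (measurable_past_chain hs (Nat.le_succ n))
      (measurable_past_eval (Nat.lt_succ_self n)))

lemma measurable_cycleSum (hs : ∀ x, Measurable (step x)) {G : S → E → ℝ≥0∞}
    (hG : ∀ x, Measurable (G x)) : Measurable (cycleSum step x₀ G) := by
  classical
  refine Measurable.tsum fun n => ?_
  exact Measurable.ite (past_le _ _ (measurableSet_past_away hs n))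
    ((measurable_past_cycle_term hs hG n).mono (past_le _) le_rfl) measurable_const

variable (p : Measure E) [IsProbabilityMeasure p]

/-- Strong Markov property at the return time. On the event that the return happens at time `r`, the
cycle sum depends on the first `r` terms only and the remaining noise is `shift r ω`; independence
holds for each `r`, and one sums over `r`. -/
lemma measure_cycleSum_inter_afterReturn (hs : ∀ x, Measurable (step x)) {G : S → E → ℝ≥0∞}
    (hG : ∀ x, Measurable (G x))
    (hR : ∀ᵐ ω ∂(Measure.infinitePi fun _ : ℕ => p), returnTime step x₀ ω ≠ 0)
    {A : Set ℝ≥0∞} (hA : MeasurableSet A) {B : Set (ℕ → E)} (hB : MeasurableSet B) :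
    (Measure.infinitePi fun _ : ℕ => p)
        (cycleSum step x₀ G ⁻¹' A ∩ afterReturn step x₀ ⁻¹' B) =
      (Measure.infinitePi fun _ : ℕ => p) (cycleSum step x₀ G ⁻¹' A) *
        (Measure.infinitePi fun _ : ℕ => p) B := by
  set P : Measure (ℕ → E) := Measure.infinitePi fun _ : ℕ => p
  have hdecomp : ∀ D : Set (ℕ → E), MeasurableSet D →
      P D = ∑' r, P (D ∩ {ω | returnTime step x₀ ω = r}) := by
    intro D hD
    rw [← measure_iUnion]
    · congr 1
      ext ω
      simp
    · intro r s hrs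
      refine Set.disjoint_left.2 ?_
      rintro ω ⟨_, h1⟩ ⟨_, h2⟩
      exact hrs (h1.symm.trans h2)
    · exact fun r => hD.inter (measurable_returnTime hs (measurableSet_singleton r))
  have hY : MeasurableSet (cycleSum step x₀ G ⁻¹' A) := measurable_cycleSum hs hG hA
  have hT : MeasurableSet (afterReturn step x₀ ⁻¹' B) := measurable_afterReturn hs hB
  rw [hdecomp _ (hY.inter hT), hdecomp _ hY, ← ENNReal.tsum_mul_right]
  congr 1
  funext r
  rcases Nat.eq_zero_or_pos r with rfl | hr
  · have h0 : P {ω | returnTime step x₀ ω = 0} = 0 := by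
      rw [ae_iff] at hR
      simpa using hR
    rw [measure_mono_null Set.inter_subset_right h0, measure_mono_null Set.inter_subset_right h0,
      zero_mul]
  · have hset : (cycleSum step x₀ G ⁻¹' A ∩ afterReturn step x₀ ⁻¹' B) ∩
        {ω | returnTime step x₀ ω = r} =
        (cycleSum step x₀ G ⁻¹' A ∩ {ω | returnTime step x₀ ω = r}) ∩ shift r ⁻¹' B := by
      ext ω
      simp only [Set.mem_inter_iff, Set.mem_preimage, Set.mem_ofPred_eq]
      constructor
      · rintro ⟨⟨h1, h2⟩, h3⟩
        rw [afterReturn, h3] at h2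
        exact ⟨⟨h1, h3⟩, h2⟩
      · rintro ⟨⟨h1, h3⟩, h2⟩
        refine ⟨⟨h1, ?_⟩, h3⟩
        rw [afterReturn, h3]
        exact h2
    have hset2 : cycleSum step x₀ G ⁻¹' A ∩ {ω | returnTime step x₀ ω = r} =
        (fun ω : ℕ → E => ∑ n ∈ Finset.range r, G (chain step x₀ ω n) (ω n)) ⁻¹' A ∩
          {ω | returnTime step x₀ ω = r} := by
      ext ω
      simp only [Set.mem_inter_iff, Set.mem_preimage, Set.mem_ofPred_eq]
      refine and_congr_left fun h => ?_
      rw [cycleSum_eq_sum_range (by omega), h]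
    have hpast : MeasurableSet[past E r]
        (cycleSum step x₀ G ⁻¹' A ∩ {ω | returnTime step x₀ ω = r}) := by
      rw [hset2]
      refine MeasurableSet.inter ?_ (measurableSet_past_returnTime hs hr)
      refine Finset.measurable_sum (m := past E r) _ (fun n hn => ?_) hA
      exact (measurable_past_cycle_term hs hG n).mono
        (past_mono (Finset.mem_range.1 hn)) le_rfl
    rw [hset, (Indep_iff _ _ _).1 (indep_past_shift p r) _ _ hpast ⟨B, hB, rfl⟩,
      (measurePreserving_shift p r).measure_preimage hB.nullMeasurableSet]

lemma measurePreserving_afterReturn (hs : ∀ x, Measurable (step x))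
    (hR : ∀ᵐ ω ∂(Measure.infinitePi fun _ : ℕ => p), returnTime step x₀ ω ≠ 0) :
    MeasurePreserving (afterReturn step x₀) (Measure.infinitePi fun _ : ℕ => p)
      (Measure.infinitePi fun _ : ℕ => p) := by
  refine ⟨measurable_afterReturn hs, ?_⟩
  ext B hB
  rw [Measure.map_apply (measurable_afterReturn hs) hB]
  have h := measure_cycleSum_inter_afterReturn p hs (G := fun _ _ => 0)
    (fun _ => measurable_const) hR MeasurableSet.univ hB
  simpa using h

/-- The strong law of large numbers for sums over cycles. -/
lemma strong_law_cycleSum (hs : ∀ x, Measurable (step x)) {G : S → E → ℝ≥0∞}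
    (hG : ∀ x, Measurable (G x))
    (hR : ∀ᵐ ω ∂(Measure.infinitePi fun _ : ℕ => p), returnTime step x₀ ω ≠ 0) :
    ∀ᵐ ω ∂(Measure.infinitePi fun _ : ℕ => p),
      Tendsto (fun n : ℕ => (∑ i ∈ Finset.range n,
        cycleSum step x₀ G ((afterReturn step x₀)^[i] ω)) / (n : ℝ≥0∞)) atTop
        (𝓝 (∫⁻ ω, cycleSum step x₀ G ω ∂(Measure.infinitePi fun _ : ℕ => p))) := by
  set P : Measure (ℕ → E) := Measure.infinitePi fun _ : ℕ => p
  have hmp := measurePreserving_afterReturn p hs hR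
  have hY := measurable_cycleSum (x₀ := x₀) hs hG
  have hlt : ∀ i j, i < j → IndepFun (fun ω => cycleSum step x₀ G ((afterReturn step x₀)^[i] ω))
      (fun ω => cycleSum step x₀ G ((afterReturn step x₀)^[j] ω)) P := by
    intro i j hij
    obtain ⟨k, rfl⟩ := Nat.exists_eq_add_of_lt hij
    rw [indepFun_iff_measure_inter_preimage_eq_mul]
    intro A B hA hB
    have hB' : MeasurableSet ((fun ω => cycleSum step x₀ G ((afterReturn step x₀)^[k] ω)) ⁻¹' B) :=
      (hY.comp (hmp.iterate k).measurable) hB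
    have e1 : (fun ω => cycleSum step x₀ G ((afterReturn step x₀)^[i] ω)) ⁻¹' A =
        (afterReturn step x₀)^[i] ⁻¹' (cycleSum step x₀ G ⁻¹' A) := rfl
    -- Both events are pulled back along the first `i` returns, which preserve the measure; this
    -- leaves cycle `0` against an event of the noise after the first return.
    have e2 : (fun ω => cycleSum step x₀ G ((afterReturn step x₀)^[i + k + 1] ω)) ⁻¹' B =
        (afterReturn step x₀)^[i] ⁻¹' (afterReturn step x₀ ⁻¹'
          ((fun ω => cycleSum step x₀ G ((afterReturn step x₀)^[k] ω)) ⁻¹' B)) := by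
      ext ω
      simp only [Set.mem_preimage]
      rw [← Function.iterate_succ_apply, ← Function.iterate_add_apply]
      rw [show k.succ + i = i + k + 1 by omega]
    have hA' := hY hA
    have hC := hmp.measurable hB'
    rw [e1, e2, ← Set.preimage_inter,
      (hmp.iterate i).measure_preimage (hA'.inter hC).nullMeasurableSet,
      (hmp.iterate i).measure_preimage hA'.nullMeasurableSet,
      (hmp.iterate i).measure_preimage hC.nullMeasurableSet,
      hmp.measure_preimage hB'.nullMeasurableSet,
      measure_cycleSum_inter_afterReturn p hs hG hR hA hB']
  refine strong_law_ennreal (fun i ω => cycleSum step x₀ G ((afterReturn step x₀)^[i] ω))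
    (fun i => hY.comp (hmp.iterate i).measurable) ?_ ?_
  · intro i j hij
    rcases lt_or_gt_of_ne hij with h | h
    · exact hlt i j h
    · exact (hlt j i h).symm
  · intro i
    refine ⟨(hY.comp (hmp.iterate i).measurable).aemeasurable, hY.aemeasurable, ?_⟩
    have : (fun ω => cycleSum step x₀ G ((afterReturn step x₀)^[i] ω)) =
      cycleSum step x₀ G ∘ (afterReturn step x₀)^[i] := rfl
    rw [this, ← Measure.map_map hY (hmp.iterate i).measurable, (hmp.iterate i).map_eq]
    rfl

lemma ae_forall_returnTime_ne_zero (hs : ∀ x, Measurable (step x))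
    (hR : ∀ᵐ ω ∂(Measure.infinitePi fun _ : ℕ => p), returnTime step x₀ ω ≠ 0) :
    ∀ᵐ ω ∂(Measure.infinitePi fun _ : ℕ => p),
      ∀ j, returnTime step x₀ ((afterReturn step x₀)^[j] ω) ≠ 0 := by
  rw [ae_all_iff]
  intro j
  exact ((measurePreserving_afterReturn p hs hR).iterate j).quasiMeasurePreserving.ae hR

end Cycles

/-! ### Expected visits in a cycle and the invariant measure -/

section Visits

variable {S E : Type*} [MeasurableSpace E]

/-- The probability to be in `x` at time `n` without having returned to `x₀`. -/
def taboo (p : Measure E) (step : S → E → S) (x₀ : S) (n : ℕ) (x : S) : ℝ≥0∞ :=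
  (Measure.infinitePi fun _ : ℕ => p) {ω | Away step x₀ ω n ∧ chain step x₀ ω n = x}

/-- The expected number of visits to `x` in a cycle. -/
def visits (p : Measure E) (step : S → E → S) (x₀ : S) (x : S) : ℝ≥0∞ :=
  ∑' n, taboo p step x₀ n x

/-- The transition probabilities. -/
def trans (p : Measure E) (step : S → E → S) (x y : S) : ℝ≥0∞ := p {e | step x e = y}

variable {step : S → E → S} {x₀ : S} (p : Measure E)

lemma taboo_zero [IsProbabilityMeasure p] : taboo p step x₀ 0 x₀ = 1 ∧ ∀ x, x ≠ x₀ → taboo p step x₀ 0 x = 0 := by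
  have h : ∀ ω : ℕ → E, Away step x₀ ω 0 := fun ω k h1 h2 => by omega
  constructor
  · simp [taboo, h, chain]
  · intro x hx
    simp [taboo, h, chain, hx.symm]

lemma taboo_succ_self (n : ℕ) : taboo p step x₀ (n + 1) x₀ = 0 := by
  rw [taboo]
  convert measure_empty (μ := Measure.infinitePi fun _ : ℕ => p)
  rw [Set.eq_empty_iff_forall_notMem]
  rintro ω ⟨h1, h2⟩
  exact h1 (n + 1) (by omega) le_rfl h2

lemma visits_self [IsProbabilityMeasure p] : visits p step x₀ x₀ = 1 := by
  rw [visits, tsum_eq_single 0]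
  · exact (taboo_zero p).1
  · intro n hn
    obtain ⟨k, rfl⟩ := Nat.exists_eq_succ_of_ne_zero hn
    exact taboo_succ_self p k

variable [Countable S] [MeasurableSpace S] [MeasurableSingletonClass S]

lemma measurableSet_past_taboo (hs : ∀ x, Measurable (step x)) (n : ℕ) (x : S) :
    MeasurableSet[past E n] {ω : ℕ → E | Away step x₀ ω n ∧ chain step x₀ ω n = x} :=
  (measurableSet_past_away hs n).inter
    (measurable_past_chain hs le_rfl (measurableSet_singleton x))

variable [IsProbabilityMeasure p]

-- The position at time `n` and the event of not having returned depend on the first `n` terms,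
-- while `ω n` is fresh; so one may split according to the position and integrate `G x` separately.
open Classical in
lemma lintegral_cycle_term (hs : ∀ x, Measurable (step x)) {G : S → E → ℝ≥0∞}
    (hG : ∀ x, Measurable (G x)) (n : ℕ) :
    ∫⁻ ω, (if Away step x₀ ω n then G (chain step x₀ ω n) (ω n) else 0)
      ∂(Measure.infinitePi fun _ : ℕ => p) =
      ∑' x, taboo p step x₀ n x * ∫⁻ e, G x e ∂p := by
  have hm := fun x => measurableSet_past_taboo (x₀ := x₀) hs n x
  have h1 : ∀ ω : ℕ → E, (if Away step x₀ ω n then G (chain step x₀ ω n) (ω n) else 0) =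
      ∑' x, {ω : ℕ → E | Away step x₀ ω n ∧ chain step x₀ ω n = x}.indicator
        (fun _ => (1 : ℝ≥0∞)) ω * G x (ω n) := by
    intro ω
    rw [tsum_eq_single (chain step x₀ ω n)]
    · by_cases h : Away step x₀ ω n <;> simp [h]
    · intro x hx
      rw [Set.indicator_of_notMem, zero_mul]
      exact fun h => hx h.2.symm
  simp_rw [h1]
  rw [lintegral_tsum]
  · congr 1
    funext x
    rw [lintegral_mul_eval p (Measurable.indicator (m := past E n) measurable_const (hm x)) (hG x),
      lintegral_indicator (past_le _ _ (hm x))]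
    simp [taboo]
  · exact fun x => ((measurable_const.indicator (past_le _ _ (hm x))).mul
      ((hG x).comp (measurable_pi_apply n))).aemeasurable

/-- Expected sums over a cycle in terms of the expected numbers of visits. -/
lemma lintegral_cycleSum (hs : ∀ x, Measurable (step x)) {G : S → E → ℝ≥0∞}
    (hG : ∀ x, Measurable (G x)) :
    ∫⁻ ω, cycleSum step x₀ G ω ∂(Measure.infinitePi fun _ : ℕ => p) =
      ∑' x, visits p step x₀ x * ∫⁻ e, G x e ∂p := by
  classical
  have h1 : ∀ ω : ℕ → E, cycleSum step x₀ G ω =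
    ∑' n, if Away step x₀ ω n then G (chain step x₀ ω n) (ω n) else 0 := fun ω => by
      unfold cycleSum
      congr
  simp_rw [h1]
  rw [lintegral_tsum]
  · simp_rw [lintegral_cycle_term p hs hG, visits, ← ENNReal.tsum_mul_right]
    exact ENNReal.tsum_comm
  · intro n
    exact (Measurable.ite (past_le _ _ (measurableSet_past_away hs n))
      ((measurable_past_cycle_term hs hG n).mono (past_le _) le_rfl)
      measurable_const).aemeasurable

lemma tsum_taboo_mul_trans (hs : ∀ x, Measurable (step x)) (n : ℕ) (y : S) :
    ∑' x, taboo p step x₀ n x * trans p step x y =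
      (Measure.infinitePi fun _ : ℕ => p) {ω | Away step x₀ ω n ∧ chain step x₀ ω (n + 1) = y} := by
  classical
  have hy : ∀ x, MeasurableSet {e | step x e = y} := fun x => hs x (measurableSet_singleton y)
  have h := lintegral_cycle_term (x₀ := x₀) p hs
    (G := fun x => {e | step x e = y}.indicator fun _ => 1)
    (fun x => measurable_const.indicator (hy x)) n
  simp only [lintegral_indicator (hy _), lintegral_const, one_mul, Measure.restrict_apply_univ]
    at h
  rw [show (∑' x, taboo p step x₀ n x * trans p step x y) = _ from h.symm, ← lintegral_indicator_one]
  · congr 1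
    funext ω
    by_cases h1 : Away step x₀ ω n <;> by_cases h2 : step (chain step x₀ ω n) (ω n) = y <;>
      simp [h1, h2, chain, Set.indicator]
  · exact (past_le _ _ (measurableSet_past_away hs n)).inter
      (past_le _ _ (measurable_past_chain hs le_rfl (measurableSet_singleton y)))

lemma taboo_succ (hs : ∀ x, Measurable (step x)) (n : ℕ) {y : S} (hy : y ≠ x₀) :
    taboo p step x₀ (n + 1) y = ∑' x, taboo p step x₀ n x * trans p step x y := by
  rw [tsum_taboo_mul_trans p hs, taboo]
  congr 1
  ext ω
  simp only [Set.mem_ofPred_eq]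
  refine and_congr_left fun h => ⟨fun h1 k hk hk2 => h1 k hk (by omega), fun h1 k hk hk2 => ?_⟩
  rcases Nat.lt_or_ge n k with hlt | hge
  · rw [show k = n + 1 by omega, h]
    exact hy
  · exact h1 k hk hge

/-- Minimality of the visit counts among excessive measures: the bound for visits before time `n`
passes through one transition to visits before time `n + 1`. -/
lemma visits_le {m : S → ℝ≥0∞} (hs : ∀ x, Measurable (step x)) (h₀ : m x₀ = 1)
    (hm : ∀ y, ∑' x, m x * trans p step x y ≤ m y) (y : S) : visits p step x₀ y ≤ m y := by
  have key : ∀ n y, ∑ k ∈ Finset.range n, taboo p step x₀ k y ≤ m y := by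
    intro n
    induction n with
    | zero => simp
    | succ n ih =>
      intro y
      rw [Finset.sum_range_succ']
      by_cases hy : y = x₀
      · subst hy
        simp [taboo_succ_self, (taboo_zero p).1, h₀]
      · rw [(taboo_zero p).2 y hy, add_zero]
        simp_rw [taboo_succ p hs _ hy]
        rw [← Summable.tsum_finsetSum fun _ _ => ENNReal.summable]
        refine (ENNReal.tsum_le_tsum fun x => ?_).trans (hm y)
        rw [← Finset.sum_mul]
        gcongr
        exact ih x
  rw [visits, ENNReal.tsum_eq_iSup_nat]
  exact iSup_le fun n => key n y

lemma measure_away (hs : ∀ x, Measurable (step x)) (n : ℕ) :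
    (Measure.infinitePi fun _ : ℕ => p) {ω | Away step x₀ ω n} = ∑' x, taboo p step x₀ n x := by
  classical
  have h := lintegral_cycle_term (x₀ := x₀) p hs (G := fun _ _ => 1) (fun _ => measurable_const) n
  simp only [lintegral_const, measure_univ, mul_one] at h
  rw [← h, ← lintegral_indicator_one (past_le _ _ (measurableSet_past_away hs n))]
  congr 1

/-- The probabilities of being still away at time `n` add up to the total of `visits`, which is at
most that of `m`. They are therefore summable and tend to `0`. -/
lemma ae_returnTime_ne_zero {m : S → ℝ≥0∞} (hs : ∀ x, Measurable (step x)) (h₀ : m x₀ = 1)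
    (hm : ∀ y, ∑' x, m x * trans p step x y ≤ m y) (hfin : ∑' x, m x ≠ ∞) :
    ∀ᵐ ω ∂(Measure.infinitePi fun _ : ℕ => p), returnTime step x₀ ω ≠ 0 := by
  have hsum : ∑' n, (Measure.infinitePi fun _ : ℕ => p) {ω | Away step x₀ ω n} ≠ ∞ := by
    simp_rw [measure_away p hs]
    rw [ENNReal.tsum_comm]
    exact ne_top_of_le_ne_top hfin (ENNReal.tsum_le_tsum fun x => visits_le p hs h₀ hm x)
  have ht := ENNReal.tendsto_atTop_zero_of_tsum_ne_top hsum
  rw [ae_iff]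
  refine le_antisymm (ge_of_tendsto' ht fun n => measure_mono ?_) (zero_le)
  intro ω hω
  exact away_of_returnTime_eq_zero (by simpa using hω) n

/-- For `y ≠ x₀` each visit has a predecessor in the same cycle. For `y = x₀` the right side bounds
the probability of returning, which is `1`. -/
lemma visits_le_tsum (hs : ∀ x, Measurable (step x))
    (hR : ∀ᵐ ω ∂(Measure.infinitePi fun _ : ℕ => p), returnTime step x₀ ω ≠ 0) (y : S) :
    visits p step x₀ y ≤ ∑' x, visits p step x₀ x * trans p step x y := by
  have h1 : ∑' x, visits p step x₀ x * trans p step x y =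
      ∑' n, ∑' x, taboo p step x₀ n x * trans p step x y := by
    simp_rw [visits, ← ENNReal.tsum_mul_right]
    exact ENNReal.tsum_comm
  rw [h1]
  by_cases hy : y = x₀
  · subst hy
    rw [visits_self]
    simp_rw [tsum_taboo_mul_trans p hs]
    calc (1 : ℝ≥0∞) = (Measure.infinitePi fun _ : ℕ => p) {ω | returnTime step y ω ≠ 0} :=
          (prob_compl_eq_zero_iff₀ (by exact
            (measurable_returnTime hs (measurableSet_singleton 0)).compl.nullMeasurableSet)
            |>.1 hR).symm
      _ ≤ (Measure.infinitePi fun _ : ℕ => p)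
          (⋃ n, {ω | Away step y ω n ∧ chain step y ω (n + 1) = y}) := by
        refine measure_mono fun ω hω => ?_
        obtain ⟨k, hk⟩ := Nat.exists_eq_succ_of_ne_zero hω
        have := (returnTime_eq_iff (by omega)).1 hk
        exact Set.mem_iUnion.2 ⟨k, this.2, this.1⟩
      _ ≤ _ := measure_iUnion_le _
  · rw [visits, tsum_eq_zero_add' ENNReal.summable, (taboo_zero p).2 y hy, zero_add]
    simp_rw [taboo_succ p hs _ hy]
    exact le_rfl

/-- Uniqueness of the invariant measure: expected visits in a cycle are given by any finite
invariant measure that is `1` at `x₀`. -/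
lemma visits_eq {m : S → ℝ≥0∞} (hs : ∀ x, Measurable (step x)) (h₀ : m x₀ = 1)
    (hm : ∀ y, ∑' x, m x * trans p step x y ≤ m y) (hfin : ∑' x, m x ≠ ∞)
    (hirr : ∀ x, m x ≠ 0 → Relation.ReflTransGen (fun x y => trans p step x y ≠ 0) x x₀) (x : S) :
    visits p step x₀ x = m x := by
  have hle := visits_le p hs h₀ hm
  by_cases hx : m x = 0
  · exact le_antisymm (hle x) (hx ▸ zero_le)
  have hR := ae_returnTime_ne_zero p hs h₀ hm hfin
  refine Relation.ReflTransGen.head_induction_on (hirr x hx) ?_ ?_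
  · rw [visits_self, h₀]
  · intro x y hxy _ ih
    -- A strict deficit at `x` would be carried by the positive transition `x → y` to a strict
    -- deficit at `y`, where equality is already known; this goes backwards along the path from `x`
    -- to `x₀`.
    by_contra hne
    have hlt : visits p step x₀ x < m x := lt_of_le_of_ne (hle x) hne
    have hxt : trans p step x y ≠ ∞ := measure_ne_top _ _
    have hmy : m y ≠ ∞ := ENNReal.ne_top_of_tsum_ne_top hfin y
    have h1 : ∑' x, visits p step x₀ x * trans p step x y <
        ∑' x, m x * trans p step x y := by
      refine ENNReal.tsum_lt_tsum (i := x) ?_ (fun a => by gcongr; exact hle a)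
        (ENNReal.mul_lt_mul_left hxy hxt hlt)
      exact ne_top_of_le_ne_top hmy
        ((ENNReal.tsum_le_tsum fun a => by gcongr; exact hle a).trans (hm y))
    exact absurd ((visits_le_tsum p hs hR y).trans_lt (h1.trans_le (hm y))) (by rw [ih]; simp)

end Visits

/-! ### From limits along cycle ends to limits of averages -/

lemma tendsto_succ_div {X : ℕ → ℝ≥0∞} {x : ℝ≥0∞}
    (h : Tendsto (fun j : ℕ => X j / (j : ℝ≥0∞)) atTop (𝓝 x)) :
    Tendsto (fun j : ℕ => X (j + 1) / (j : ℝ≥0∞)) atTop (𝓝 x) := by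
  have h1 : Tendsto (fun j : ℕ => 1 + (j : ℝ≥0∞)⁻¹) atTop (𝓝 (1 + 0)) :=
    tendsto_const_nhds.add ENNReal.tendsto_inv_nat_nhds_zero
  rw [add_zero] at h1
  have h2 := ENNReal.Tendsto.mul (h.comp (tendsto_add_atTop_nat 1)) (Or.inr ENNReal.one_ne_top) h1
    (Or.inl one_ne_zero)
  rw [mul_one] at h2
  refine h2.congr' ?_
  filter_upwards [eventually_gt_atTop 0] with j hj
  have hj0 : (j : ℝ≥0∞) ≠ 0 := by exact_mod_cast hj.ne'
  have hj1 : ((j + 1 : ℕ) : ℝ≥0∞) ≠ 0 := by exact_mod_cast Nat.succ_ne_zero j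
  have e : 1 + (j : ℝ≥0∞)⁻¹ = ((j + 1 : ℕ) : ℝ≥0∞) * (j : ℝ≥0∞)⁻¹ := by
    push_cast
    rw [add_mul, ENNReal.mul_inv_cancel hj0 (ENNReal.natCast_ne_top j), one_mul]
  simp only [Function.comp]
  rw [e, div_eq_mul_inv, div_eq_mul_inv, mul_assoc, ← mul_assoc (_⁻¹),
    ENNReal.inv_mul_cancel hj1 (ENNReal.natCast_ne_top _), one_mul]

lemma exists_lt_of_tendsto_div {S : ℕ → ℕ} {s : ℝ≥0∞} (hs0 : s ≠ 0)
    (h1 : Tendsto (fun j : ℕ => (S j : ℝ≥0∞) / (j : ℝ≥0∞)) atTop (𝓝 s)) (n : ℕ) :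
    ∃ j, n < S j := by
  by_contra! hle
  have h3 : Tendsto (fun j : ℕ => (n : ℝ≥0∞) * (j : ℝ≥0∞)⁻¹) atTop (𝓝 ((n : ℝ≥0∞) * 0)) :=
    ENNReal.Tendsto.const_mul ENNReal.tendsto_inv_nat_nhds_zero
      (Or.inr (ENNReal.natCast_ne_top n))
  rw [mul_zero] at h3
  refine hs0 (le_antisymm (le_of_tendsto_of_tendsto' h1 h3 fun j => ?_) zero_le)
  rw [div_eq_mul_inv]
  gcongr
  exact hle j

/-- Averages converge if they do so, suitably normalized, along cycle ends. -/
lemma tendsto_div_of_cycles {W : ℕ → ℝ≥0∞} (hW : Monotone W) {S : ℕ → ℕ} (hS : Monotone S)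
    (hS0 : S 0 = 0) {a s : ℝ≥0∞} (hs0 : s ≠ 0) (hs1 : s ≠ ∞)
    (h1 : Tendsto (fun j : ℕ => (S j : ℝ≥0∞) / (j : ℝ≥0∞)) atTop (𝓝 s))
    (h2 : Tendsto (fun j : ℕ => W (S j) / (j : ℝ≥0∞)) atTop (𝓝 a)) :
    Tendsto (fun n : ℕ => W n / (n : ℝ≥0∞)) atTop (𝓝 (a / s)) := by
  have hunb : ∀ n, ∃ j, n < S (j + 1) := fun n => by
    obtain ⟨j, hj⟩ := exists_lt_of_tendsto_div hs0 h1 n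
    exact ⟨j, hj.trans_le (hS (Nat.le_succ j))⟩
  classical
  -- `J n` is the index of the cycle that contains item `n`: `S (J n) ≤ n < S (J n + 1)`.
  -- Monotonicity then squeezes `n` and `W n` between values at two consecutive cycle ends.
  let J : ℕ → ℕ := fun n => Nat.find (hunb n)
  have hJ1 : ∀ n, n < S (J n + 1) := fun n => Nat.find_spec (hunb n)
  have hJ2 : ∀ n, S (J n) ≤ n := by
    intro n
    rcases Nat.eq_zero_or_pos (J n) with h | h
    · rw [h, hS0]
      exact Nat.zero_le n
    · have := Nat.find_min (hunb n) (m := J n - 1) (by change _ < J n; omega)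
      rw [Nat.sub_add_cancel h] at this
      omega
  have hJ : Tendsto J atTop atTop := by
    refine tendsto_atTop.2 fun K => ?_
    filter_upwards [eventually_ge_atTop (S K)] with n hn
    by_contra hlt
    have := hS (show J n + 1 ≤ K by omega)
    have := hJ1 n
    omega
  have t1 : Tendsto (fun n : ℕ => (n : ℝ≥0∞) / (J n : ℝ≥0∞)) atTop (𝓝 s) := by
    refine tendsto_of_tendsto_of_tendsto_of_le_of_le (h1.comp hJ)
      ((tendsto_succ_div (X := fun j => (S j : ℝ≥0∞)) h1).comp hJ) (fun n => ?_) (fun n => ?_)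
    · simp only [Function.comp]
      gcongr
      exact hJ2 n
    · simp only [Function.comp]
      gcongr
      exact (hJ1 n).le
  have t2 : Tendsto (fun n : ℕ => W n / (J n : ℝ≥0∞)) atTop (𝓝 a) := by
    refine tendsto_of_tendsto_of_tendsto_of_le_of_le (h2.comp hJ)
      ((tendsto_succ_div (X := fun j => W (S j)) h2).comp hJ) (fun n => ?_) (fun n => ?_)
    · simp only [Function.comp]
      gcongr
      exact hW (hJ2 n)
    · simp only [Function.comp]
      gcongr
      exact hW (hJ1 n).le
  refine (ENNReal.Tendsto.div t2 (Or.inr hs0) t1 (Or.inl hs1)).congr' ?_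
  filter_upwards [hJ.eventually_gt_atTop 0] with n hn
  have hj0 : (J n : ℝ≥0∞) ≠ 0 := by exact_mod_cast hn.ne'
  have hj1 : (J n : ℝ≥0∞) ≠ ∞ := ENNReal.natCast_ne_top _
  exact ENNReal.mul_div_mul_right _ _ (ENNReal.inv_ne_zero.2 hj1) (ENNReal.inv_ne_top.2 hj0)

end Regeneration
end

/-! ### The noise of one jump and the transitions of the queue lengths -/

noncomputable section

namespace MealDelivery

lemma measurable_gammaPDF_one_one : Measurable (gammaPDF 1 1) :=
  (measurable_gammaPDFReal 1 1).ennreal_ofReal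

lemma ae_expMeasure_nonneg : ∀ᵐ x ∂(expMeasure 1), 0 ≤ x := by
  rw [expMeasure, gammaMeasure, ae_withDensity_iff measurable_gammaPDF_one_one]
  refine Eventually.of_forall fun x hx => ?_
  by_contra h
  exact hx (gammaPDF_of_neg (not_le.1 h))

/-- The integral is `Γ(2)`. -/
lemma lintegral_expMeasure_id : ∫⁻ x, ENNReal.ofReal x ∂(expMeasure 1) = 1 := by
  have h1 : ∫⁻ x, ENNReal.ofReal x ∂(expMeasure 1) =
      ∫⁻ x in Set.Ioi 0, ENNReal.ofReal (Real.exp (-x) * x ^ ((2 : ℝ) - 1)) := by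
    rw [expMeasure, gammaMeasure, lintegral_withDensity_eq_lintegral_mul _
      measurable_gammaPDF_one_one ENNReal.measurable_ofReal,
      ← lintegral_indicator measurableSet_Ioi]
    congr 1
    funext x
    change exponentialPDF 1 x * ENNReal.ofReal x = _
    rw [exponentialPDF_eq]
    by_cases hx : 0 < x
    · rw [Set.indicator_of_mem (Set.mem_Ioi.2 hx), if_pos hx.le,
        ← ENNReal.ofReal_mul (by positivity)]
      norm_num
    · rw [Set.indicator_of_notMem (fun h => hx (Set.mem_Ioi.1 h)),
        ENNReal.ofReal_of_nonpos (not_lt.1 hx), mul_zero]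
  rw [h1, ← ofReal_integral_eq_lintegral_ofReal (Real.GammaIntegral_convergent two_pos),
    ← Real.Gamma_eq_integral two_pos, Real.Gamma_two, ENNReal.ofReal_one]
  filter_upwards [ae_restrict_mem measurableSet_Ioi] with x hx
  have : (0 : ℝ) < x := hx
  positivity

lemma volume_mul_lt {T c : ℝ} (hT : 0 < T) (h0 : 0 ≤ c) (h1 : c ≤ T) :
    (volume : Measure unitInterval) {u | (u : ℝ) * T < c} = ENNReal.ofReal (c / T) := by
  have hm : c / T ∈ unitInterval := ⟨by positivity, (div_le_one hT).2 h1⟩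
  have : {u : unitInterval | (u : ℝ) * T < c} = Set.Iio ⟨c / T, hm⟩ := by
    ext u
    simp only [Set.mem_ofPred_eq, Set.mem_Iio, ← Subtype.coe_lt_coe]
    exact (lt_div_iff₀ hT).symm
  rw [this, unitInterval.volume_Iio]

lemma measurableSet_mul_lt (T c : ℝ) : MeasurableSet {u : unitInterval | (u : ℝ) * T < c} :=
  measurableSet_lt (measurable_subtype_coe.mul_const T) measurable_const

/-- The law of the noise of one jump. -/
abbrev jumpNoise : Measure (ℝ × unitInterval) := (expMeasure 1).prod volume

/-- The preparation rate as a function of the queue lengths. -/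
def prep (μ : ℝ) (x : ℕ × ℤ) : ℝ := if 0 < x.1 then μ else 0

/-- The dispatch rate as a function of the queue lengths. -/
def dispatch (P : Policy) (x : ℕ × ℤ) : ℝ :=
  if -(P.buffer : ℤ) < x.2 then P.rate (signal P.threshold x.2) else 0

/-- The total jump rate as a function of the queue lengths. -/
def total (μ : ℝ) (P : Policy) (x : ℕ × ℤ) : ℝ := 1 + prep μ x + dispatch P x

/-- The jump of the queue lengths. -/
def queueStep (μ : ℝ) (P : Policy) (x : ℕ × ℤ) (e : ℝ × unitInterval) : ℕ × ℤ :=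
  if (e.2 : ℝ) * total μ P x < 1 then (x.1 + 1, x.2)
  else if (e.2 : ℝ) * total μ P x < 1 + prep μ x then (x.1 - 1, x.2 + 1)
  else (x.1, x.2 - 1)

lemma measurable_queueStep (μ : ℝ) (P : Policy) (x : ℕ × ℤ) : Measurable (queueStep μ P x) :=
  Measurable.ite (measurable_snd (measurableSet_mul_lt _ _)) measurable_const
    (Measurable.ite (measurable_snd (measurableSet_mul_lt _ _)) measurable_const measurable_const)

variable {μ Λ : ℝ} {P : Policy}

lemma Policy.Admissible.rate_pos' (hP : P.Admissible μ Λ) (i : ℕ) : 0 < P.rate i := by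
  rcases Nat.eq_zero_or_pos i with rfl | hi
  · exact one_pos.trans hP.one_lt_rate_zero
  · exact hP.rate_pos i hi

lemma Policy.Admissible.prep_nonneg (hP : P.Admissible μ Λ) (x : ℕ × ℤ) : 0 ≤ prep μ x := by
  have := hP.one_lt_prep
  unfold prep
  split_ifs <;> linarith

lemma Policy.Admissible.dispatch_nonneg (hP : P.Admissible μ Λ) (x : ℕ × ℤ) :
    0 ≤ dispatch P x := by
  unfold dispatch
  split_ifs
  · exact (hP.rate_pos' _).le
  · exact le_rfl

lemma Policy.Admissible.total_pos (hP : P.Admissible μ Λ) (x : ℕ × ℤ) : 0 < total μ P x := by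
  have := hP.prep_nonneg x
  have := hP.dispatch_nonneg x
  unfold total
  linarith

lemma Policy.Admissible.total_le (hP : P.Admissible μ Λ) (x : ℕ × ℤ) :
    total μ P x ≤ 1 + μ + Λ := by
  have h1 := hP.one_lt_prep
  have h2 := hP.one_lt_max
  have h3 : prep μ x ≤ μ := by
    unfold prep
    split_ifs <;> linarith
  have h4 : dispatch P x ≤ Λ := by
    unfold dispatch
    split_ifs
    · exact hP.rate_le _
    · linarith
  unfold total
  linarith

lemma measure_snd (q : unitInterval → Prop) : jumpNoise {e | q e.2} = volume {u | q u} := by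
  have : {e : ℝ × unitInterval | q e.2} = Set.univ ×ˢ {u | q u} := by
    ext e
    simp
  rw [this, Measure.prod_prod, measure_univ, one_mul]

open Regeneration

/-- The transition probabilities of the queue lengths. -/
lemma trans_queueStep (hP : P.Admissible μ Λ) (x y : ℕ × ℤ) :
    trans jumpNoise (queueStep μ P) x y =
      ((if y = (x.1 + 1, x.2) then 1 else 0)
        + (if y = (x.1 - 1, x.2 + 1) then ENNReal.ofReal (prep μ x) else 0)
        + (if y = (x.1, x.2 - 1) then ENNReal.ofReal (dispatch P x) else 0))
        / ENNReal.ofReal (total μ P x) := by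
  have hT := hP.total_pos x
  have hp := hP.prep_nonneg x
  have hd := hP.dispatch_nonneg x
  have hdef : total μ P x = 1 + prep μ x + dispatch P x := rfl
  have key : trans jumpNoise (queueStep μ P) x y = volume {u : unitInterval |
      (if (u : ℝ) * total μ P x < 1 then (x.1 + 1, x.2)
        else if (u : ℝ) * total μ P x < 1 + prep μ x then (x.1 - 1, x.2 + 1)
        else (x.1, x.2 - 1)) = y} :=
    measure_snd fun u => (if (u : ℝ) * total μ P x < 1 then (x.1 + 1, x.2)
        else if (u : ℝ) * total μ P x < 1 + prep μ x then (x.1 - 1, x.2 + 1)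
        else (x.1, x.2 - 1)) = y
  have hmono : ∀ u : unitInterval, (u : ℝ) * total μ P x < 1 →
      (u : ℝ) * total μ P x < 1 + prep μ x := fun u hu => by linarith
  rw [key]
  by_cases hA : y = (x.1 + 1, x.2)
  · have hB : y ≠ (x.1 - 1, x.2 + 1) := by rw [hA]; simp
    have hC : y ≠ (x.1, x.2 - 1) := by rw [hA]; simp
    rw [if_pos hA, if_neg hB, if_neg hC]
    have : {u : unitInterval |
      (if (u : ℝ) * total μ P x < 1 then (x.1 + 1, x.2)
        else if (u : ℝ) * total μ P x < 1 + prep μ x then (x.1 - 1, x.2 + 1)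
        else (x.1, x.2 - 1)) = y} = {u : unitInterval | (u : ℝ) * total μ P x < 1} := by
      ext u
      simp only [Set.mem_ofPred_eq]
      split_ifs with h1 h2
      · simp [hA, h1]
      · simp [h1, hB.symm]
      · simp [h1, hC.symm]
    rw [this, volume_mul_lt hT zero_le_one (by linarith), ENNReal.ofReal_div_of_pos hT]
    simp
  by_cases hB : y = (x.1 - 1, x.2 + 1)
  · have hC : y ≠ (x.1, x.2 - 1) := by
      rw [hB]
      intro h
      have := congrArg Prod.snd h
      simp only at this
      omega
    rw [if_neg hA, if_pos hB, if_neg hC]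
    have : {u : unitInterval |
      (if (u : ℝ) * total μ P x < 1 then (x.1 + 1, x.2)
        else if (u : ℝ) * total μ P x < 1 + prep μ x then (x.1 - 1, x.2 + 1)
        else (x.1, x.2 - 1)) = y} = {u : unitInterval | (u : ℝ) * total μ P x < 1 + prep μ x} \
          {u : unitInterval | (u : ℝ) * total μ P x < 1} := by
      ext u
      simp only [Set.mem_ofPred_eq, Set.mem_sdiff]
      split_ifs with h1 h2
      · simp [h1, Ne.symm hA]
      · simp [h1, h2, hB]
      · simp [h2, hC.symm]
    have hsub : {u : unitInterval | (u : ℝ) * total μ P x < 1} ⊆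
        {u : unitInterval | (u : ℝ) * total μ P x < 1 + prep μ x} := hmono
    rw [this, measure_sdiff hsub (measurableSet_mul_lt _ _).nullMeasurableSet
      (measure_ne_top _ _), volume_mul_lt hT zero_le_one (by linarith),
      volume_mul_lt hT (by linarith) (by linarith),
      ← ENNReal.ofReal_sub _ (by positivity), ← sub_div, add_sub_cancel_left,
      ENNReal.ofReal_div_of_pos hT]
    simp
  by_cases hC : y = (x.1, x.2 - 1)
  · rw [if_neg hA, if_neg hB, if_pos hC]
    have : {u : unitInterval |
      (if (u : ℝ) * total μ P x < 1 then (x.1 + 1, x.2)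
        else if (u : ℝ) * total μ P x < 1 + prep μ x then (x.1 - 1, x.2 + 1)
        else (x.1, x.2 - 1)) = y} =
          {u : unitInterval | (u : ℝ) * total μ P x < 1 + prep μ x}ᶜ := by
      ext u
      simp only [Set.mem_ofPred_eq, Set.mem_compl_iff]
      split_ifs with h1 h2
      · simp [hmono u h1, Ne.symm hA]
      · simp [h2, Ne.symm hB]
      · simp [h2, hC]
    rw [this, prob_compl_eq_one_sub (measurableSet_mul_lt _ _),
      volume_mul_lt hT (by linarith) (by linarith), ← ENNReal.ofReal_one,
      ← ENNReal.ofReal_sub _ (by positivity)]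
    rw [show 1 - (1 + prep μ x) / total μ P x = dispatch P x / total μ P x by
      field_simp; rw [hdef]; ring, ENNReal.ofReal_div_of_pos hT]
    simp
  · rw [if_neg hA, if_neg hB, if_neg hC]
    have : {u : unitInterval |
      (if (u : ℝ) * total μ P x < 1 then (x.1 + 1, x.2)
        else if (u : ℝ) * total μ P x < 1 + prep μ x then (x.1 - 1, x.2 + 1)
        else (x.1, x.2 - 1)) = y} = ∅ := by
      ext u
      simp only [Set.mem_ofPred_eq, Set.mem_empty_iff_false, iff_false]
      split_ifs
      · exact Ne.symm hA
      · exact Ne.symm hB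
      · exact Ne.symm hC
    rw [this]
    simp

/-! ### Product-form stationary weights and positive recurrence -/

/-- The unnormalized stationary weights of `Q₂`, indexed by `Q₂ + d`. -/
def weightNat (P : Policy) (n : ℕ) : ℝ≥0∞ :=
  ∏ i ∈ Finset.range n,
    (ENNReal.ofReal (P.rate (signal P.threshold ((i : ℤ) + 1 - P.buffer))))⁻¹

/-- The unnormalized stationary weights of `Q₂`. -/
def weight (P : Policy) (q : ℤ) : ℝ≥0∞ :=
  if q < -(P.buffer : ℤ) then 0 else weightNat P (q + P.buffer).toNat

/-- The unnormalized stationary weights of `(Q₁, Q₂)`. -/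
def stationary (μ : ℝ) (P : Policy) (x : ℕ × ℤ) : ℝ≥0∞ :=
  (ENNReal.ofReal μ)⁻¹ ^ x.1 * weight P x.2

lemma weight_of_lt {q : ℤ} (h : q < -(P.buffer : ℤ)) : weight P q = 0 := if_pos h

lemma weight_sub_buffer (n : ℕ) : weight P ((n : ℤ) - P.buffer) = weightNat P n := by
  rw [weight, if_neg (by omega)]
  congr 1
  omega

lemma weight_add_one {q : ℤ} (h : -(P.buffer : ℤ) ≤ q) :
    weight P (q + 1) =
      weight P q * (ENNReal.ofReal (P.rate (signal P.threshold (q + 1))))⁻¹ := by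
  obtain ⟨n, hn⟩ := Int.eq_ofNat_of_zero_le (show 0 ≤ q + P.buffer by omega)
  obtain rfl : q = (n : ℤ) - P.buffer := by omega
  rw [show (n : ℤ) - P.buffer + 1 = ((n + 1 : ℕ) : ℤ) - P.buffer by push_cast; ring,
    weight_sub_buffer, weight_sub_buffer, weightNat, Finset.prod_range_succ]
  congr 5

/-- Balance across the cut between `q` and `q + 1`, with prepared orders arriving at rate `1`. It
also holds at the edge `q = -d - 1`, where the weight of `q` and the dispatch rate at `q + 1` both
vanish. -/
lemma weight_mul_dispatch (hP : P.Admissible μ Λ) (a : ℕ) (q : ℤ) :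
    weight P (q + 1) * ENNReal.ofReal (dispatch P (a, q + 1)) = weight P q := by
  rcases lt_or_ge q (-(P.buffer : ℤ)) with h | h
  · rw [weight_of_lt h]
    rcases lt_or_ge (q + 1) (-(P.buffer : ℤ)) with h' | h'
    · rw [weight_of_lt h', zero_mul]
    · rw [dispatch, if_neg (by simp only; omega), ENNReal.ofReal_zero, mul_zero]
  · rw [weight_add_one h, dispatch, if_pos (by simp only; omega), mul_assoc,
      ENNReal.inv_mul_cancel _ ENNReal.ofReal_ne_top, mul_one]
    exact (ENNReal.ofReal_pos.2 (hP.rate_pos' _)).ne'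

lemma weight_ne_zero {q : ℤ} (h : -(P.buffer : ℤ) ≤ q) : weight P q ≠ 0 := by
  rw [weight, if_neg (by omega), weightNat, Finset.prod_ne_zero_iff]
  exact fun i _ => ENNReal.inv_ne_zero.2 ENNReal.ofReal_ne_top

lemma weight_ne_top (hP : P.Admissible μ Λ) (q : ℤ) : weight P q ≠ ∞ := by
  unfold weight
  split_ifs
  · exact ENNReal.zero_ne_top
  · refine ENNReal.prod_ne_top fun i _ => ENNReal.inv_ne_top.2 ?_
    exact (ENNReal.ofReal_pos.2 (hP.rate_pos' _)).ne'

/-- The unnormalized stationary weights of the jump chain. -/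
def jumpStationary (μ : ℝ) (P : Policy) (x : ℕ × ℤ) : ℝ≥0∞ :=
  stationary μ P x * ENNReal.ofReal (total μ P x)

lemma ofReal_total (hP : P.Admissible μ Λ) (x : ℕ × ℤ) :
    ENNReal.ofReal (total μ P x) =
      1 + ENNReal.ofReal (prep μ x) + ENNReal.ofReal (dispatch P x) := by
  have h1 := hP.prep_nonneg x
  rw [total, ENNReal.ofReal_add (by linarith) (hP.dispatch_nonneg x),
    ENNReal.ofReal_add zero_le_one h1, ENNReal.ofReal_one]

lemma ofReal_total_ne_zero (hP : P.Admissible μ Λ) (x : ℕ × ℤ) :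
    ENNReal.ofReal (total μ P x) ≠ 0 := (ENNReal.ofReal_pos.2 (hP.total_pos x)).ne'

lemma tsum_arrival (y : ℕ × ℤ) :
    ∑' x : ℕ × ℤ, stationary μ P x * (if y = (x.1 + 1, x.2) then 1 else 0) =
      if 0 < y.1 then stationary μ P (y.1 - 1, y.2) else 0 := by
  obtain ⟨a, q⟩ := y
  by_cases ha : 0 < a
  · rw [tsum_eq_single (a - 1, q)]
    · simp only [ha, if_true]
      rw [if_pos (by simp; omega), mul_one]
    · rintro ⟨b, r⟩ hne
      rw [if_neg, mul_zero]
      simp only [Prod.mk.injEq, not_and]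
      intro h1 h2
      exact hne (Prod.ext (by simp only; omega) h2.symm)
  · rw [if_neg ha, ENNReal.tsum_eq_zero]
    rintro ⟨b, r⟩
    rw [if_neg, mul_zero]
    simp only [Prod.mk.injEq, not_and]
    intro h1
    omega

lemma tsum_preparation (hμ : 0 < μ) (y : ℕ × ℤ) :
    ∑' x : ℕ × ℤ, stationary μ P x *
        (if y = (x.1 - 1, x.2 + 1) then ENNReal.ofReal (prep μ x) else 0) =
      stationary μ P (y.1, y.2 - 1) := by
  obtain ⟨a, q⟩ := y
  have hμ' : ENNReal.ofReal μ ≠ 0 := (ENNReal.ofReal_pos.2 hμ).ne'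
  rw [tsum_eq_single (a + 1, q - 1)]
  · rw [if_pos (by simp), prep, if_pos (by simp), stationary, stationary]
    simp only
    rw [pow_succ, mul_right_comm, mul_assoc _ _ (ENNReal.ofReal μ),
      ENNReal.inv_mul_cancel hμ' ENNReal.ofReal_ne_top, mul_one]
  · rintro ⟨b, r⟩ hne
    by_cases hb : 0 < b
    · rw [if_neg, mul_zero]
      simp only [Prod.mk.injEq, not_and]
      intro h1 h2
      exact hne (Prod.ext (by simp only; omega) (by simp only; omega))
    -- For `b = 0` the truncated `b - 1` is `0` and could match the target, but the preparation rate
    -- is then `0`.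
    · simp [prep, hb]

lemma tsum_dispatch (hP : P.Admissible μ Λ) (y : ℕ × ℤ) :
    ∑' x : ℕ × ℤ, stationary μ P x *
        (if y = (x.1, x.2 - 1) then ENNReal.ofReal (dispatch P x) else 0) =
      stationary μ P y := by
  obtain ⟨a, q⟩ := y
  rw [tsum_eq_single (a, q + 1)]
  · rw [if_pos (by simp), stationary, mul_assoc, weight_mul_dispatch hP]
    rfl
  · rintro ⟨b, r⟩ hne
    rw [if_neg, mul_zero]
    simp only [Prod.mk.injEq, not_and]
    intro h1 h2
    exact hne (Prod.ext h1.symm (by simp only; omega))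

/-- Global balance. -/
lemma jumpStationary_invariant (hP : P.Admissible μ Λ) (y : ℕ × ℤ) :
    ∑' x, jumpStationary μ P x * trans jumpNoise (queueStep μ P) x y = jumpStationary μ P y := by
  have hμ : 0 < μ := one_pos.trans hP.one_lt_prep
  have hμ' : ENNReal.ofReal μ ≠ 0 := (ENNReal.ofReal_pos.2 hμ).ne'
  have h1 : ∀ x, jumpStationary μ P x * trans jumpNoise (queueStep μ P) x y =
      stationary μ P x * (if y = (x.1 + 1, x.2) then 1 else 0)
      + stationary μ P x * (if y = (x.1 - 1, x.2 + 1) then ENNReal.ofReal (prep μ x) else 0)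
      + stationary μ P x * (if y = (x.1, x.2 - 1) then ENNReal.ofReal (dispatch P x) else 0) := by
    intro x
    rw [trans_queueStep hP, jumpStationary, mul_assoc,
      ENNReal.mul_div_cancel (ofReal_total_ne_zero hP x) ENNReal.ofReal_ne_top, mul_add, mul_add]
  simp_rw [h1]
  rw [ENNReal.tsum_add, ENNReal.tsum_add, tsum_arrival, tsum_preparation hμ, tsum_dispatch hP,
    jumpStationary, ofReal_total hP, mul_add, mul_add, mul_one]
  -- Partial balance at `y`: arrivals in match preparations out (`e1`), preparations in match
  -- dispatches out (`e2`), and dispatches in match arrivals out (`tsum_dispatch`).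
  have e1 : (if 0 < y.1 then stationary μ P (y.1 - 1, y.2) else 0) =
      stationary μ P y * ENNReal.ofReal (prep μ y) := by
    unfold prep
    by_cases hy : 0 < y.1
    · rw [if_pos hy, if_pos hy, stationary, stationary]
      obtain ⟨k, hk⟩ := Nat.exists_eq_succ_of_ne_zero hy.ne'
      simp only [hk, Nat.succ_eq_add_one, Nat.add_sub_cancel]
      rw [pow_succ, mul_right_comm, mul_assoc _ _ (ENNReal.ofReal μ),
        ENNReal.inv_mul_cancel hμ' ENNReal.ofReal_ne_top, mul_one]
    · rw [if_neg hy, if_neg hy, ENNReal.ofReal_zero, mul_zero]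
  have e2 : stationary μ P (y.1, y.2 - 1) = stationary μ P y * ENNReal.ofReal (dispatch P y) := by
    have h := weight_mul_dispatch hP y.1 (y.2 - 1)
    rw [sub_add_cancel] at h
    rw [stationary, stationary, mul_assoc, h]
  rw [e1, e2]
  ring

lemma tsum_stationary_mul (f : ℕ → ℝ≥0∞) (g : ℤ → ℝ≥0∞) :
    ∑' x : ℕ × ℤ, stationary μ P x * (f x.1 * g x.2) =
      (∑' a : ℕ, (ENNReal.ofReal μ)⁻¹ ^ a * f a) * ∑' q : ℤ, weight P q * g q := by
  rw [ENNReal.tsum_prod', ← ENNReal.tsum_mul_right]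
  congr 1
  funext a
  rw [← ENNReal.tsum_mul_left]
  congr 1
  funext q
  simp only [stationary]
  ring

lemma tsum_inv_pow_ne_top (hμ : 1 < μ) : ∑' a : ℕ, (ENNReal.ofReal μ)⁻¹ ^ a ≠ ∞ := by
  rw [ENNReal.tsum_geometric]
  refine ENNReal.inv_ne_top.2 (tsub_pos_iff_lt.2 ?_).ne'
  rw [ENNReal.inv_lt_one, ← ENNReal.ofReal_one]
  exact (ENNReal.ofReal_lt_ofReal_iff (by linarith)).2 hμ

lemma tsum_stationary_ne_top (hP : P.Admissible μ Λ) (hw : ∑' q, weight P q ≠ ∞) :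
    ∑' x, stationary μ P x ≠ ∞ := by
  have h := tsum_stationary_mul (μ := μ) (P := P) (fun _ => 1) (fun _ => 1)
  simp only [mul_one] at h
  rw [h]
  exact ENNReal.mul_ne_top (tsum_inv_pow_ne_top hP.one_lt_prep) hw

lemma tsum_jumpStationary_ne_top (hP : P.Admissible μ Λ) (hw : ∑' q, weight P q ≠ ∞) :
    ∑' x, jumpStationary μ P x ≠ ∞ := by
  refine ne_top_of_le_ne_top (b := (∑' x, stationary μ P x) * ENNReal.ofReal (1 + μ + Λ))
    (ENNReal.mul_ne_top (tsum_stationary_ne_top hP hw) ENNReal.ofReal_ne_top) ?_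
  rw [← ENNReal.tsum_mul_right]
  refine ENNReal.tsum_le_tsum fun x => ?_
  unfold jumpStationary
  gcongr
  exact hP.total_le x

/-- The empty system can be reached from every state with at most `d` waiting riders. -/
lemma reaches_empty (hP : P.Admissible μ Λ) (x : ℕ × ℤ) (hx : -(P.buffer : ℤ) ≤ x.2) :
    Relation.ReflTransGen (fun x y => trans jumpNoise (queueStep μ P) x y ≠ 0) x (0, 0) := by
  have hμ : 0 < μ := one_pos.trans hP.one_lt_prep
  have hne : ∀ x y : ℕ × ℤ, ((if y = (x.1 + 1, x.2) then 1 else 0)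
        + (if y = (x.1 - 1, x.2 + 1) then ENNReal.ofReal (prep μ x) else 0)
        + (if y = (x.1, x.2 - 1) then ENNReal.ofReal (dispatch P x) else 0)) ≠ (0 : ℝ≥0∞) →
      trans jumpNoise (queueStep μ P) x y ≠ 0 := by
    intro x y h
    rw [trans_queueStep hP]
    exact ENNReal.div_ne_zero.2 ⟨h, ENNReal.ofReal_ne_top⟩
  have order : ∀ (a : ℕ) (q : ℤ), trans jumpNoise (queueStep μ P) (a, q) (a + 1, q) ≠ 0 := by
    intro a q
    apply hne
    simp
  have prepare : ∀ (a : ℕ) (q : ℤ),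
      trans jumpNoise (queueStep μ P) (a + 1, q) (a, q + 1) ≠ 0 := by
    intro a q
    apply hne
    simp [prep, hμ]
  have ride : ∀ n : ℕ, trans jumpNoise (queueStep μ P) (0, (n : ℤ) + 1) (0, (n : ℤ)) ≠ 0 := by
    intro n
    apply hne
    have : 0 < dispatch P (0, (n : ℤ) + 1) := by
      rw [dispatch, if_pos (by simp only; omega)]
      exact hP.rate_pos' _
    simp [this]
  have h1 : ∀ n : ℕ, Relation.ReflTransGen
      (fun x y => trans jumpNoise (queueStep μ P) x y ≠ 0) (0, (n : ℤ)) (0, 0) := by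
    intro n
    induction n with
    | zero => exact Relation.ReflTransGen.refl
    | succ n ih =>
      refine Relation.ReflTransGen.head ?_ ih
      push_cast
      exact ride n
  have h2 : ∀ (a : ℕ) (q : ℤ), 0 ≤ (a : ℤ) + q → Relation.ReflTransGen
      (fun x y => trans jumpNoise (queueStep μ P) x y ≠ 0) (a, q) (0, 0) := by
    intro a
    induction a with
    | zero =>
      intro q hq
      obtain ⟨n, rfl⟩ := Int.eq_ofNat_of_zero_le (show 0 ≤ q by omega)
      exact h1 n
    | succ a ih =>
      intro q hq
      exact Relation.ReflTransGen.head (prepare a q) (ih (q + 1) (by push_cast at hq; omega))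
  have h3 : ∀ (k a : ℕ) (q : ℤ), 0 ≤ (k : ℤ) + a + q → Relation.ReflTransGen
      (fun x y => trans jumpNoise (queueStep μ P) x y ≠ 0) (a, q) (0, 0) := by
    intro k
    induction k with
    | zero =>
      intro a q h
      exact h2 a q (by push_cast at h; omega)
    | succ k ih =>
      intro a q h
      exact Relation.ReflTransGen.head (order a q) (ih _ _ (by push_cast at h ⊢; omega))
  -- New orders first make up for the waiting riders; then everything is prepared, and riders fetch
  -- what is left.
  exact h3 (-x.2).toNat x.1 x.2 (by have := hx; omega)

lemma jumpStationary_empty_ne_zero (hP : P.Admissible μ Λ) : jumpStationary μ P (0, 0) ≠ 0 := by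
  refine mul_ne_zero (mul_ne_zero (by simp) (weight_ne_zero (by simp))) (ofReal_total_ne_zero hP _)

lemma jumpStationary_empty_ne_top (hP : P.Admissible μ Λ) : jumpStationary μ P (0, 0) ≠ ∞ :=
  ENNReal.mul_ne_top (ENNReal.mul_ne_top (by simp) (weight_ne_top hP _)) ENNReal.ofReal_ne_top

lemma normalized_invariant (hP : P.Admissible μ Λ) (y : ℕ × ℤ) :
    ∑' x, jumpStationary μ P x / jumpStationary μ P (0, 0) *
        trans jumpNoise (queueStep μ P) x y ≤
      jumpStationary μ P y / jumpStationary μ P (0, 0) := by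
  simp_rw [div_eq_mul_inv, mul_right_comm _ (jumpStationary μ P (0, 0))⁻¹]
  rw [ENNReal.tsum_mul_right, jumpStationary_invariant hP]

lemma normalized_tsum_ne_top (hP : P.Admissible μ Λ) (hw : ∑' q, weight P q ≠ ∞) :
    ∑' x, jumpStationary μ P x / jumpStationary μ P (0, 0) ≠ ∞ := by
  simp_rw [div_eq_mul_inv]
  rw [ENNReal.tsum_mul_right]
  exact ENNReal.mul_ne_top (tsum_jumpStationary_ne_top hP hw)
    (ENNReal.inv_ne_top.2 (jumpStationary_empty_ne_zero hP))

lemma visits_queue (hP : P.Admissible μ Λ) (hw : ∑' q, weight P q ≠ ∞) (x : ℕ × ℤ) :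
    visits jumpNoise (queueStep μ P) (0, 0) x =
      jumpStationary μ P x / jumpStationary μ P (0, 0) := by
  refine visits_eq jumpNoise (measurable_queueStep μ P)
    (m := fun x => jumpStationary μ P x / jumpStationary μ P (0, 0))
    (ENNReal.div_self (jumpStationary_empty_ne_zero hP) (jumpStationary_empty_ne_top hP))
    (normalized_invariant hP) (normalized_tsum_ne_top hP hw) (fun x hx => ?_) x
  refine reaches_empty hP x ?_
  by_contra h
  exact hx (by simp [jumpStationary, stationary, weight_of_lt (not_le.1 h)])

lemma ae_returnTime_queue (hP : P.Admissible μ Λ) (hw : ∑' q, weight P q ≠ ∞) :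
    ∀ᵐ ω ∂noiseMeasure, returnTime (queueStep μ P) (0, 0) ω ≠ 0 :=
  ae_returnTime_ne_zero jumpNoise (measurable_queueStep μ P)
    (m := fun x => jumpStationary μ P x / jumpStationary μ P (0, 0))
    (ENNReal.div_self (jumpStationary_empty_ne_zero hP) (jumpStationary_empty_ne_top hP))
    (normalized_invariant hP) (normalized_tsum_ne_top hP hw)

/-- Expected sums over a cycle of quantities whose mean in the state `x` is `f x / total x`. -/
lemma lintegral_cycleSum_queue (hP : P.Admissible μ Λ) (hw : ∑' q, weight P q ≠ ∞)
    {G : ℕ × ℤ → ℝ × unitInterval → ℝ≥0∞} (hG : ∀ x, Measurable (G x)) {f : ℕ × ℤ → ℝ≥0∞}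
    (hf : ∀ x, ∫⁻ e, G x e ∂jumpNoise = f x / ENNReal.ofReal (total μ P x)) :
    ∫⁻ ω, cycleSum (queueStep μ P) (0, 0) G ω ∂noiseMeasure =
      (∑' x, stationary μ P x * f x) / jumpStationary μ P (0, 0) := by
  refine (lintegral_cycleSum jumpNoise (measurable_queueStep μ P) hG).trans ?_
  rw [div_eq_mul_inv, ← ENNReal.tsum_mul_right]
  congr 1
  funext x
  rw [visits_queue hP hw, hf, jumpStationary, div_eq_mul_inv, div_eq_mul_inv]
  -- The total rate in the weight of the jump chain cancels the one in the mean of `G x`, which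
  -- leaves the weights of the continuous-time chain.
  have := ENNReal.mul_inv_cancel (ofReal_total_ne_zero hP x) ENNReal.ofReal_ne_top
  calc _ = stationary μ P x * f x * (jumpStationary μ P (0, 0))⁻¹ *
        (ENNReal.ofReal (total μ P x) * (ENNReal.ofReal (total μ P x))⁻¹) := by ring
    _ = _ := by rw [this, mul_one]

/-! ### Little's law along trajectories -/

/-- Little's law over a cycle: the item number `k` is present at the steps `n` with
`a n ≤ k < g n`. -/
lemma sum_sojourn_eq (h : ℕ → ℝ≥0∞) {a g : ℕ → ℕ} (ha : Monotone a) (hg : Monotone g) {T : ℕ}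
    (hT : a T = g T) :
    ∑ k ∈ Finset.range (g T), ∑' n, (if a n ≤ k ∧ k < g n then h n else 0) =
      ∑ n ∈ Finset.range T, h n * ((g n - a n : ℕ) : ℝ≥0∞) := by
  rw [← Summable.tsum_finsetSum fun _ _ => ENNReal.summable,
    tsum_eq_sum (s := Finset.range T)]
  · refine Finset.sum_congr rfl fun n hn => ?_
    have hn' : g n ≤ g T := hg (Finset.mem_range.1 hn).le
    have hfilter : (Finset.range (g T)).filter (fun k => a n ≤ k ∧ k < g n) =
        Finset.Ico (a n) (g n) := by
      ext k
      simp only [Finset.mem_filter, Finset.mem_range, Finset.mem_Ico]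
      omega
    rw [← Finset.sum_filter, hfilter, Finset.sum_const, Nat.card_Ico, nsmul_eq_mul, mul_comm]
  · intro n hn
    refine Finset.sum_eq_zero fun k hk => if_neg ?_
    have h1 : a T ≤ a n := ha (not_lt.1 fun h => hn (Finset.mem_range.2 h))
    have h2 := Finset.mem_range.1 hk
    omega

lemma sum_range_eq_tsum (h : ℕ → ℝ≥0∞) {g : ℕ → ℕ} {k N : ℕ} (hN : ∀ n, k < g n ↔ N ≤ n) :
    ∑ n ∈ Finset.range N, h n = ∑' n, if g n ≤ k then h n else 0 := by
  rw [tsum_eq_sum (s := Finset.range N)]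
  · refine Finset.sum_congr rfl fun n hn => ?_
    rw [if_pos]
    have := Finset.mem_range.1 hn
    by_contra hlt
    exact absurd ((hN n).1 (not_le.1 hlt)) (by omega)
  · intro n hn
    rw [if_neg]
    exact not_le.2 ((hN n).2 (not_lt.1 fun h => hn (Finset.mem_range.2 h)))

lemma exists_first_exceed {g : ℕ → ℕ} (hg : Monotone g) {k : ℕ} (h : ∃ n, k < g n) :
    ∃ N, ∀ n, k < g n ↔ N ≤ n := by
  classical
  exact ⟨Nat.find h, fun n => ⟨fun hn => Nat.find_min' h hn,
    fun hn => (Nat.find_spec h).trans_le (hg hn)⟩⟩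

/-- The pair `(Q₁, Q₂)`. -/
def queues (x : Counts) : ℕ × ℤ := (x.q₁, x.q₂)

/-- If the processing queue is empty, the two thresholds for `u` coincide; so a preparation ends
only when there is an order to prepare. -/
lemma step_cases (x : Counts) (u : ℝ) :
    step μ P x u = { x with ordered := x.ordered + 1 } ∨
      (0 < x.q₁ ∧ step μ P x u = { x with prepared := x.prepared + 1 }) ∨
      step μ P x u = { x with riders := x.riders + 1 } := by
  unfold step
  split_ifs with h1 h2
  · exact Or.inl rfl
  · refine Or.inr (Or.inl ⟨?_, rfl⟩)
    by_contra h
    rw [prepRate, if_neg h, add_zero] at h2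
    exact h1 h2
  · exact Or.inr (Or.inr rfl)

lemma prepared_le_ordered (ω : Noise) (n : ℕ) :
    (counts μ P ω n).prepared ≤ (counts μ P ω n).ordered := by
  induction n with
  | zero => exact le_rfl
  | succ n ih =>
    rw [counts]
    rcases step_cases (μ := μ) (P := P) (counts μ P ω n) (ω n).2 with h | ⟨h0, h⟩ | h
    · rw [h]
      exact ih.trans (Nat.le_succ _)
    · rw [h]
      simp only [Counts.q₁] at h0 ⊢
      omega
    · rw [h]
      exact ih

/-- The hypothesis keeps the truncated subtraction in `Counts.q₁` exact. -/
lemma queues_step {x : Counts} (hx : x.prepared ≤ x.ordered) (e : ℝ × unitInterval) :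
    queues (step μ P x e.2) = queueStep μ P (queues x) e := by
  have ht : total μ P (queues x) = totalRate μ P x := rfl
  have hp : prep μ (queues x) = prepRate μ x := rfl
  unfold step queueStep
  rw [ht, hp]
  split_ifs with h1 h2
  · ext
    · simp only [queues, Counts.q₁]
      omega
    · rfl
  · ext
    · simp only [queues, Counts.q₁]
      omega
    · simp only [queues, Counts.q₂]
      push_cast
      ring
  · ext
    · rfl
    · simp only [queues, Counts.q₂]
      push_cast
      ring

lemma chain_queueStep (ω : Noise) (n : ℕ) :
    chain (queueStep μ P) (0, 0) ω n = queues (counts μ P ω n) := by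
  induction n with
  | zero => rfl
  | succ n ih => rw [chain, ih, counts, queues_step (prepared_le_ordered ω n)]

/-- The holding time in the state number `n`. -/
def holding (μ : ℝ) (P : Policy) (ω : Noise) (n : ℕ) : ℝ≥0∞ :=
  ENNReal.ofReal ((ω n).1 / totalRate μ P (counts μ P ω n))

lemma ofReal_jumpTime (hP : P.Admissible μ Λ) {ω : Noise} (hω : ∀ n, 0 ≤ (ω n).1) (N : ℕ) :
    ENNReal.ofReal (jumpTime μ P ω N) = ∑ n ∈ Finset.range N, holding μ P ω n :=
  ENNReal.ofReal_sum_of_nonneg fun n _ =>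
    div_nonneg (hω n) (hP.total_pos (queues (counts μ P ω n))).le

lemma timeOf_eq (hP : P.Admissible μ Λ) {ω : Noise} (hω : ∀ n, 0 ≤ (ω n).1) {f : Counts → ℕ}
    {k N : ℕ} (hN : ∀ n, k < f (counts μ P ω n) ↔ N ≤ n) :
    timeOf μ P ω f k = ∑ n ∈ Finset.range N, holding μ P ω n := by
  rw [← ofReal_jumpTime hP hω]
  refine le_antisymm (iInf₂_le N ((hN N).2 le_rfl)) (le_iInf₂ fun n hn => ?_)
  rw [ofReal_jumpTime hP hω, ofReal_jumpTime hP hω]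
  exact Finset.sum_le_sum_of_subset (Finset.range_mono ((hN n).1 hn))

/-- The number of fetched orders. -/
def fetched (x : Counts) : ℕ := min x.prepared x.riders

lemma fetchTime_eq (hP : P.Admissible μ Λ) {ω : Noise} (hω : ∀ n, 0 ≤ (ω n).1) {k N₁ N₂ : ℕ}
    (h₁ : ∀ n, k < (counts μ P ω n).prepared ↔ N₁ ≤ n)
    (h₂ : ∀ n, k < (counts μ P ω n).riders ↔ N₂ ≤ n) :
    fetchTime μ P ω k = ∑ n ∈ Finset.range (max N₁ N₂), holding μ P ω n := by
  have hmono : Monotone fun N => ∑ n ∈ Finset.range N, holding μ P ω n :=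
    fun a b hab => Finset.sum_le_sum_of_subset (Finset.range_mono hab)
  rw [fetchTime, timeOf_eq hP hω h₁, timeOf_eq hP hω h₂]
  exact (hmono.map_max (a := N₁) (b := N₂)).symm

lemma monotone_counts {f : Counts → ℕ} (hf : ∀ x u, f x ≤ f (step μ P x u)) (ω : Noise) :
    Monotone fun n => f (counts μ P ω n) :=
  monotone_nat_of_le_succ fun n => hf (counts μ P ω n) (ω n).2

lemma ordered_le_step (x : Counts) (u : ℝ) : x.ordered ≤ (step μ P x u).ordered := by
  rcases step_cases (μ := μ) (P := P) x u with h | ⟨-, h⟩ | h <;> rw [h]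
  exact Nat.le_succ _

lemma prepared_le_step (x : Counts) (u : ℝ) : x.prepared ≤ (step μ P x u).prepared := by
  rcases step_cases (μ := μ) (P := P) x u with h | ⟨-, h⟩ | h <;> rw [h]
  exact Nat.le_succ _

lemma riders_le_step (x : Counts) (u : ℝ) : x.riders ≤ (step μ P x u).riders := by
  rcases step_cases (μ := μ) (P := P) x u with h | ⟨-, h⟩ | h <;> rw [h]
  exact Nat.le_succ _

/-- Item `k` is in the system exactly at the jumps where `g` has passed `k` and `fetched` has not.
With `hk` both times are finite, so the subtraction in `[0, ∞]` is a true difference. -/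
lemma wait_eq (hP : P.Admissible μ Λ) {ω : Noise} (hω : ∀ n, 0 ≤ (ω n).1) {g : Counts → ℕ}
    (hg : ∀ x u, g x ≤ g (step μ P x u))
    (hle : ∀ x : Counts, x.prepared ≤ x.ordered → fetched x ≤ g x) {k : ℕ}
    (hk : ∃ n, k < fetched (counts μ P ω n)) :
    fetchTime μ P ω k - timeOf μ P ω g k =
      ∑' n, if fetched (counts μ P ω n) ≤ k ∧ k < g (counts μ P ω n)
        then holding μ P ω n else 0 := by
  have hk₁ : ∃ n, k < (counts μ P ω n).prepared := hk.imp fun n hn => (lt_min_iff.1 hn).1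
  have hk₂ : ∃ n, k < (counts μ P ω n).riders := hk.imp fun n hn => (lt_min_iff.1 hn).2
  have hk₃ : ∃ n, k < g (counts μ P ω n) :=
    hk.imp fun n hn => hn.trans_le (hle _ (prepared_le_ordered ω n))
  obtain ⟨N₁, h₁⟩ := exists_first_exceed (monotone_counts prepared_le_step ω) hk₁
  obtain ⟨N₂, h₂⟩ := exists_first_exceed (monotone_counts riders_le_step ω) hk₂
  obtain ⟨N₃, h₃⟩ := exists_first_exceed (monotone_counts hg ω) hk₃
  have hf : ∀ n, k < fetched (counts μ P ω n) ↔ max N₁ N₂ ≤ n := by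
    intro n
    rw [fetched, lt_min_iff, max_le_iff]
    exact and_congr (h₁ n) (h₂ n)
  rw [fetchTime_eq hP hω h₁ h₂, timeOf_eq hP hω h₃]
  have hfin : ∑ n ∈ Finset.range N₃, holding μ P ω n ≠ ∞ :=
    ENNReal.sum_ne_top.2 fun n _ => ENNReal.ofReal_ne_top
  refine ENNReal.sub_eq_of_eq_add hfin ?_
  rw [sum_range_eq_tsum _ hf, sum_range_eq_tsum (g := fun n => g (counts μ P ω n)) _ h₃,
    ← ENNReal.tsum_add]
  congr 1
  funext n
  have := hle _ (prepared_le_ordered (μ := μ) (P := P) ω n)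
  by_cases c1 : fetched (counts μ P ω n) ≤ k
  · by_cases c2 : g (counts μ P ω n) ≤ k
    · rw [if_pos c1, if_neg (by omega), if_pos c2, zero_add]
    · rw [if_pos c1, if_pos ⟨c1, by omega⟩, if_neg c2, add_zero]
  · rw [if_neg c1, if_neg (by omega), if_neg (by omega), add_zero]

/-- The indicator of an order arrival. -/
def arrival (μ : ℝ) (P : Policy) (x : ℕ × ℤ) (e : ℝ × unitInterval) : ℝ≥0∞ :=
  if (e.2 : ℝ) * total μ P x < 1 then 1 else 0

/-- The contribution of a jump to the integral of `f` over time. -/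
def occupation (μ : ℝ) (P : Policy) (f : ℕ × ℤ → ℝ≥0∞) (x : ℕ × ℤ) (e : ℝ × unitInterval) :
    ℝ≥0∞ := ENNReal.ofReal (e.1 / total μ P x) * f x

lemma measurable_arrival (x : ℕ × ℤ) : Measurable (arrival μ P x) :=
  Measurable.ite (measurable_snd (measurableSet_mul_lt _ _)) measurable_const measurable_const

lemma measurable_occupation (f : ℕ × ℤ → ℝ≥0∞) (x : ℕ × ℤ) : Measurable (occupation μ P f x) :=
  ((measurable_fst.div_const _).ennreal_ofReal).mul_const _

lemma lintegral_arrival (hP : P.Admissible μ Λ) (x : ℕ × ℤ) :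
    ∫⁻ e, arrival μ P x e ∂jumpNoise = 1 / ENNReal.ofReal (total μ P x) := by
  have hT := hP.total_pos x
  have h1 : (arrival μ P x) =
      {e : ℝ × unitInterval | (e.2 : ℝ) * total μ P x < 1}.indicator 1 := by
    funext e
    simp [arrival, Set.indicator]
  have h2 := hP.prep_nonneg x
  have h3 := hP.dispatch_nonneg x
  have h4 : total μ P x = 1 + prep μ x + dispatch P x := rfl
  have h5 : MeasurableSet {e : ℝ × unitInterval | (e.2 : ℝ) * total μ P x < 1} :=
    measurable_snd (measurableSet_mul_lt _ _)
  rw [h1, lintegral_indicator_one h5,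
    measure_snd fun u => (u : ℝ) * total μ P x < 1, volume_mul_lt hT zero_le_one (by linarith),
    ENNReal.ofReal_div_of_pos hT, ENNReal.ofReal_one]

lemma lintegral_occupation (hP : P.Admissible μ Λ) (f : ℕ × ℤ → ℝ≥0∞) (x : ℕ × ℤ) :
    ∫⁻ e, occupation μ P f x e ∂jumpNoise = f x / ENNReal.ofReal (total μ P x) := by
  have hT := hP.total_pos x
  have hm : Measurable fun t : ℝ => ENNReal.ofReal t := ENNReal.measurable_ofReal
  have h : ∀ e : ℝ × unitInterval, occupation μ P f x e =
      ENNReal.ofReal e.1 * ((ENNReal.ofReal (total μ P x))⁻¹ * f x) := fun e => by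
    rw [occupation, ENNReal.ofReal_div_of_pos hT, div_eq_mul_inv, mul_assoc]
  simp_rw [h]
  rw [lintegral_mul_const _ (by fun_prop),
    (measurePreserving_fst (μ := expMeasure 1) (ν := (volume : Measure unitInterval))).lintegral_comp
      hm, lintegral_expMeasure_id, one_mul, mul_comm, div_eq_mul_inv]

lemma ae_noise_nonneg : ∀ᵐ ω ∂noiseMeasure, ∀ n, 0 ≤ (ω n).1 := by
  rw [ae_all_iff]
  intro n
  have h1 : ∀ᵐ e ∂jumpNoise, 0 ≤ e.1 :=
    measurePreserving_fst.quasiMeasurePreserving.ae ae_expMeasure_nonneg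
  exact (measurePreserving_eval_infinitePi (fun _ : ℕ => jumpNoise) n).quasiMeasurePreserving.ae h1

lemma ordered_eq_sum (ω : Noise) (N : ℕ) :
    ((counts μ P ω N).ordered : ℝ≥0∞) =
      ∑ n ∈ Finset.range N, arrival μ P (chain (queueStep μ P) (0, 0) ω n) (ω n) := by
  induction N with
  | zero => simp [counts]
  | succ N ih =>
    have ht : total μ P (queues (counts μ P ω N)) = totalRate μ P (counts μ P ω N) := rfl
    rw [Finset.sum_range_succ, ← ih, chain_queueStep, counts, arrival, ht]
    unfold step
    split_ifs
    · push_cast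
      rfl
    · simp
    · simp

/-- The mean sojourn time of orders (or riders) counted by `g` is the stationary mean of their
number in the system. -/
theorem tendsto_mean_wait (hP : P.Admissible μ Λ) (hw : ∑' q, weight P q ≠ ∞) {g : Counts → ℕ}
    (hg : ∀ x u, g x ≤ g (step μ P x u))
    (hle : ∀ x : Counts, x.prepared ≤ x.ordered → fetched x ≤ g x)
    (hg₀ : ∀ x : Counts, x.prepared = x.ordered → x.riders = x.ordered → g x = x.ordered)
    {f : ℕ × ℤ → ℝ≥0∞}
    (hf : ∀ x : Counts, x.prepared ≤ x.ordered → f (queues x) = ((g x - fetched x : ℕ) : ℝ≥0∞)) :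
    ∀ᵐ ω ∂noiseMeasure, Tendsto (fun n : ℕ =>
      (∑ k ∈ Finset.range n, (fetchTime μ P ω k - timeOf μ P ω g k)) / (n : ℝ≥0∞)) atTop
      (𝓝 ((∑' x, stationary μ P x * f x) / ∑' x, stationary μ P x)) := by
  have hR := ae_returnTime_queue hP hw
  have hms := measurable_queueStep μ P
  have hc0 := jumpStationary_empty_ne_zero hP
  have hc1 := jumpStationary_empty_ne_top hP
  have hfin := tsum_stationary_ne_top hP hw
  have hpos : ∑' x, stationary μ P x ≠ 0 := by
    intro h
    have := ENNReal.tsum_eq_zero.1 h (0, 0)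
    rw [stationary] at this
    simp [weight_ne_zero (P := P) (q := 0) (by simp)] at this
  have law₁ := strong_law_cycleSum jumpNoise hms (measurable_arrival (μ := μ) (P := P)) hR
  have law₂ := strong_law_cycleSum jumpNoise hms (measurable_occupation (μ := μ) (P := P) f) hR
  have e₁ := lintegral_cycleSum_queue hP hw measurable_arrival (f := fun _ => 1)
    (lintegral_arrival hP)
  have e₂ := lintegral_cycleSum_queue hP hw (measurable_occupation f) (lintegral_occupation hP f)
  simp only [mul_one] at e₁
  unfold noiseMeasure at e₁ e₂
  filter_upwards [ae_noise_nonneg, ae_forall_returnTime_ne_zero jumpNoise hms hR, law₁, law₂]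
    with ω hω hret h₁ h₂
  simp_rw [sum_cycleSum hret] at h₁ h₂
  rw [e₁] at h₁
  rw [e₂] at h₂
  set T : ℕ → ℕ := cycleEnd (queueStep μ P) (0, 0) ω
  have hTmono : Monotone T := monotone_nat_of_le_succ fun j => by
    simp only [T, cycleEnd, Finset.sum_range_succ]
    exact Nat.le_add_right _ _
  simp_rw [← ordered_eq_sum] at h₁
  -- At a cycle end all three counts agree, so the sojourns of the items so far are complete; the
  -- number of orders also serves as the number of riders.
  have hempty : ∀ j, (counts μ P ω (T j)).prepared = (counts μ P ω (T j)).ordered ∧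
      (counts μ P ω (T j)).riders = (counts μ P ω (T j)).ordered := by
    intro j
    have h := (iterate_afterReturn hret j).2
    rw [chain_queueStep] at h
    have hp := prepared_le_ordered (μ := μ) (P := P) ω (T j)
    have ha : (counts μ P ω (T j)).q₁ = 0 := congrArg Prod.fst h
    have hb : (counts μ P ω (T j)).q₂ = 0 := congrArg Prod.snd h
    simp only [Counts.q₁, Counts.q₂] at ha hb
    omega
  have hs0 : (∑' x, stationary μ P x) / jumpStationary μ P (0, 0) ≠ 0 :=
    ENNReal.div_ne_zero.2 ⟨hpos, hc1⟩
  have hs1 : (∑' x, stationary μ P x) / jumpStationary μ P (0, 0) ≠ ∞ :=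
    ENNReal.div_ne_top hfin hc0
  have hfetch : ∀ j, fetched (counts μ P ω (T j)) = (counts μ P ω (T j)).ordered := fun j => by
    rw [fetched, (hempty j).1, (hempty j).2, min_self]
  have hunb : ∀ k, ∃ n, k < fetched (counts μ P ω n) := fun k => by
    obtain ⟨j, hj⟩ := exists_lt_of_tendsto_div hs0 h₁ k
    exact ⟨T j, (hfetch j).symm ▸ hj⟩
  have hfmono : Monotone fun n => fetched (counts μ P ω n) := fun a b hab =>
    min_le_min (monotone_counts prepared_le_step ω hab) (monotone_counts riders_le_step ω hab)
  have hW : ∀ j, ∑ k ∈ Finset.range (counts μ P ω (T j)).ordered,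
      (fetchTime μ P ω k - timeOf μ P ω g k) =
      ∑ n ∈ Finset.range (T j), occupation μ P f (chain (queueStep μ P) (0, 0) ω n) (ω n) := by
    intro j
    have hgT : g (counts μ P ω (T j)) = (counts μ P ω (T j)).ordered :=
      hg₀ _ (hempty j).1 (hempty j).2
    simp_rw [wait_eq hP hω hg hle (hunb _)]
    rw [← hgT]
    refine (sum_sojourn_eq (holding μ P ω) (g := fun n => g (counts μ P ω n)) hfmono
      (monotone_counts hg ω) ((hfetch j).trans hgT.symm)).trans ?_
    refine Finset.sum_congr rfl fun n _ => ?_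
    rw [chain_queueStep, occupation, hf _ (prepared_le_ordered ω n)]
    rfl
  have key := tendsto_div_of_cycles
    (W := fun n => ∑ k ∈ Finset.range n, (fetchTime μ P ω k - timeOf μ P ω g k))
    (fun a b hab => Finset.sum_le_sum_of_subset (Finset.range_mono hab))
    (S := fun j => (counts μ P ω (T j)).ordered)
    ((monotone_counts ordered_le_step ω).comp hTmono) (by simp [T, cycleEnd, counts])
    hs0 hs1 h₁ (by simp_rw [hW]; exact h₂)
  -- The weight of the empty state normalizes both cycle means and cancels in their ratio.
  rwa [show _ / _ / (_ / _) = _ from ENNReal.mul_div_mul_right _ _ (ENNReal.inv_ne_zero.2 hc1)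
    (ENNReal.inv_ne_top.2 hc0)] at key

/-- The mean order waiting time. -/
theorem isMeanOrderWait (hP : P.Admissible μ Λ) (hw : ∑' q, weight P q ≠ ∞) :
    IsMeanOrderWait μ P ((∑' x : ℕ × ℤ, stationary μ P x *
      ((x.1 : ℝ≥0∞) + (x.2.toNat : ℝ≥0∞))) / ∑' x, stationary μ P x) := by
  refine tendsto_mean_wait hP hw (g := Counts.ordered) ordered_le_step
    (fun x hx => (min_le_left _ _).trans hx) (fun x _ _ => rfl) (fun x hx => ?_)
  rw [← Nat.cast_add]
  congr 1
  simp only [queues, Counts.q₁, Counts.q₂, fetched]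
  omega

/-- The mean rider waiting time. -/
theorem isMeanRiderWait (hP : P.Admissible μ Λ) (hw : ∑' q, weight P q ≠ ∞) :
    IsMeanRiderWait μ P ((∑' x : ℕ × ℤ, stationary μ P x * ((-x.2).toNat : ℝ≥0∞)) /
      ∑' x, stationary μ P x) := by
  refine tendsto_mean_wait hP hw (g := Counts.riders) riders_le_step
    (fun x _ => min_le_right _ _) (fun x _ h => h) (fun x hx => ?_)
  congr 1
  simp only [queues, Counts.q₂, fetched]
  omega

/-! ### Extremality of geometric tails -/

section Tails

/-- The term `v i` occurs once in each of the tails `k = 0, …, i`. -/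
lemma tsum_mul_succ_eq_tsum_tails (v : ℕ → ℝ≥0∞) :
    ∑' i, v i * ((i : ℝ≥0∞) + 1) = ∑' k, ∑' i, v (k + i) := by
  have h1 : ∀ k, ∑' i, v (k + i) = ∑' n, if k ≤ n then v n else 0 := by
    intro k
    rw [← (add_right_injective k).tsum_eq (f := fun n => if k ≤ n then v n else 0)]
    · simp
    · intro n hn
      have : k ≤ n := by
        by_contra h
        exact hn (if_neg h)
      exact ⟨n - k, by simp only; omega⟩
  simp_rw [h1]
  rw [ENNReal.tsum_comm]
  congr 1
  funext n
  rw [tsum_eq_sum (s := Finset.range (n + 1))]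
  · rw [Finset.sum_congr rfl fun k hk => if_pos (Nat.lt_succ_iff.1 (Finset.mem_range.1 hk))]
    simp [mul_comm]
  · intro k hk
    exact if_neg fun h => hk (Finset.mem_range.2 (Nat.lt_succ_of_le h))

lemma tsum_mul_succ_ne_top {v : ℕ → ℝ≥0∞} {r : ℝ≥0∞} (hr : r < 1) (h₀ : v 0 ≠ ∞)
    (hv : ∀ i, v (i + 1) = v i * r) : ∑' i, v i * ((i : ℝ≥0∞) + 1) ≠ ∞ := by
  obtain ⟨c, hc, h1⟩ : ∃ c ≠ ∞, ∀ i, v i = c * r ^ i := by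
    refine ⟨v 0, h₀, fun i => ?_⟩
    induction i with
    | zero => simp
    | succ i ih => rw [hv, ih, pow_succ, mul_assoc]
  have h2 : (1 - r)⁻¹ ≠ ∞ := ENNReal.inv_ne_top.2 (tsub_pos_iff_lt.2 hr).ne'
  rw [tsum_mul_succ_eq_tsum_tails]
  simp_rw [h1, pow_add, ENNReal.tsum_mul_left, ENNReal.tsum_mul_right, ENNReal.tsum_geometric]
  exact ENNReal.mul_ne_top hc (ENNReal.mul_ne_top h2 h2)

/-- Among the sequences of given sum that decrease at most by the factor `r`, the geometric one
has the lightest tails. -/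
lemma tail_le_tail {v v' : ℕ → ℝ≥0∞} {r : ℝ≥0∞} (hv : ∀ i, v i * r ≤ v (i + 1))
    (hv' : ∀ i, v' (i + 1) = v' i * r) (hsum : ∑' i, v' i = ∑' i, v i) (k : ℕ) :
    ∑' i, v' (k + i) ≤ ∑' i, v (k + i) := by
  induction k with
  | zero => simp [hsum]
  | succ k ih =>
    calc ∑' i, v' (k + 1 + i) = (∑' i, v' (k + i)) * r := by
          rw [← ENNReal.tsum_mul_right]
          congr 1
          funext i
          rw [← hv']
          congr 1
          omega
      _ ≤ (∑' i, v (k + i)) * r := by gcongr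
      _ ≤ ∑' i, v (k + 1 + i) := by
          rw [← ENNReal.tsum_mul_right]
          refine ENNReal.tsum_le_tsum fun i => (hv (k + i)).trans_eq ?_
          congr 1
          omega

lemma tsum_mul_succ_le {v v' : ℕ → ℝ≥0∞} {r : ℝ≥0∞} (hv : ∀ i, v i * r ≤ v (i + 1))
    (hv' : ∀ i, v' (i + 1) = v' i * r) (hsum : ∑' i, v' i = ∑' i, v i) :
    ∑' i, v' i * ((i : ℝ≥0∞) + 1) ≤ ∑' i, v i * ((i : ℝ≥0∞) + 1) := by
  rw [tsum_mul_succ_eq_tsum_tails, tsum_mul_succ_eq_tsum_tails]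
  exact ENNReal.tsum_le_tsum (tail_le_tail hv hv' hsum)

/-- The tails are ordered termwise, so equal finite sums of tails force equal tails; the tails from
`0` and from `1` differ by the first term. Finiteness is assumed for `v'` only, since the original
mean may be infinite. -/
lemma zero_eq_of_tsum_mul_succ_eq {v v' : ℕ → ℝ≥0∞} {r : ℝ≥0∞} (hv : ∀ i, v i * r ≤ v (i + 1))
    (hv' : ∀ i, v' (i + 1) = v' i * r) (hsum : ∑' i, v' i = ∑' i, v i)
    (hfin : ∑' i, v' i * ((i : ℝ≥0∞) + 1) ≠ ∞)
    (h : ∑' i, v' i * ((i : ℝ≥0∞) + 1) = ∑' i, v i * ((i : ℝ≥0∞) + 1)) : v' 0 = v 0 := by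
  rw [tsum_mul_succ_eq_tsum_tails] at hfin
  rw [tsum_mul_succ_eq_tsum_tails, tsum_mul_succ_eq_tsum_tails] at h
  have h1 : ∑' i, v' (1 + i) = ∑' i, v (1 + i) := by
    by_contra hne
    exact (ENNReal.tsum_lt_tsum hfin (tail_le_tail hv hv' hsum)
      (lt_of_le_of_ne (tail_le_tail hv hv' hsum 1) hne)).ne h
  have h2 : ∑' i, v' (1 + i) ≠ ∞ := ENNReal.ne_top_of_tsum_ne_top hfin 1
  rw [tsum_eq_zero_add' ENNReal.summable, tsum_eq_zero_add' (f := v) ENNReal.summable] at hsum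
  simp_rw [add_comm 1] at h1 h2
  rw [h1] at hsum h2
  exact (ENNReal.add_left_inj h2).1 hsum

end Tails

/-! ### Weights of the original and of the improved policy -/

lemma signal_eq_zero {M : ℕ∞} {q : ℤ} (h : ∀ K : ℕ, M = K → q ≤ K) : signal M q = 0 := by
  unfold signal
  split_ifs with hM
  · rfl
  · have := h M.toNat (ENat.natCast_toNat hM).symm
    omega

lemma signal_natCast (K : ℕ) (q : ℤ) : signal (K : ℕ∞) q = (q - K).toNat := by
  simp [signal]

/-- Sums against the weights, with the values above `m` split off. -/
lemma tsum_weight_mul (P : Policy) (m : ℕ) (g : ℤ → ℝ≥0∞) :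
    ∑' q, weight P q * g q =
      ∑ n ∈ Finset.range (P.buffer + m + 1), weightNat P n * g ((n : ℤ) - P.buffer) +
        ∑' i : ℕ, weight P ((m : ℤ) + 1 + i) * g ((m : ℤ) + 1 + i) := by
  have hinj : Function.Injective fun n : ℕ => (n : ℤ) - P.buffer := fun a b h => by
    simp only at h
    omega
  rw [← hinj.tsum_eq (f := fun q => weight P q * g q)]
  · simp_rw [weight_sub_buffer]
    rw [← Summable.sum_add_tsum_nat_add' (k := P.buffer + m + 1) ENNReal.summable]
    congr 2
    funext i
    rw [← weight_sub_buffer]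
    congr 2 <;> push_cast <;> ring
  · intro q hq
    have : ¬ q < -(P.buffer : ℤ) := fun h => hq (by simp [weight_of_lt h])
    exact ⟨(q + P.buffer).toNat, by simp only; omega⟩

lemma weight_succ_of_le_threshold (hP : P.Admissible μ Λ) {q : ℤ} (h : -(P.buffer : ℤ) ≤ q)
    (hq : ∀ K : ℕ, P.threshold = K → q + 1 ≤ K) :
    weight P (q + 1) = weight P q * ENNReal.ofReal (1 / P.rate 0) := by
  rw [weight_add_one h, signal_eq_zero hq, one_div,
    ENNReal.ofReal_inv_of_pos (hP.rate_pos' 0)]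

lemma weight_add_of_le_threshold (hP : P.Admissible μ Λ) (m i : ℕ)
    (hq : ∀ K : ℕ, P.threshold = K → m + i ≤ K) :
    weight P ((m : ℤ) + i) = weight P m * ENNReal.ofReal ((1 / P.rate 0) ^ i) := by
  have h0 := (hP.rate_pos' 0).le
  induction i with
  | zero => simp
  | succ i ih =>
    push_cast
    rw [← add_assoc, weight_succ_of_le_threshold hP (by omega)
      (fun K hK => by have := hq K hK; omega), ih (fun K hK => by have := hq K hK; omega),
      mul_assoc, ← ENNReal.ofReal_mul (by positivity), ← pow_succ]

lemma weight_above_threshold (hP : ∀ i, 0 < P.rate i) {K : ℕ} (hK : P.threshold = K) (i : ℕ) :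
    weight P ((K : ℤ) + 1 + i) =
      weight P K * ENNReal.ofReal (∏ j ∈ Finset.Icc 1 (i + 1), 1 / P.rate j) := by
  have hpos : ∀ n, 0 ≤ ∏ j ∈ Finset.Icc 1 n, 1 / P.rate j :=
    fun n => Finset.prod_nonneg fun j _ => (one_div_pos.2 (hP j)).le
  induction i with
  | zero =>
    rw [Nat.cast_zero, add_zero, weight_add_one (by omega), hK, signal_natCast,
      add_sub_cancel_left]
    simp [ENNReal.ofReal_inv_of_pos (hP 1)]
  | succ i ih =>
    push_cast
    rw [← add_assoc, weight_add_one (by omega), ih, hK, signal_natCast,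
      Finset.prod_Icc_succ_top (b := i + 1) (by omega), ENNReal.ofReal_mul (hpos _), mul_assoc, one_div,
      ENNReal.ofReal_inv_of_pos (hP _), show ((K : ℤ) + 1 + i + 1 - K).toNat = i + 1 + 1 by omega]

lemma tsum_weight_above_threshold (hP : ∀ i, 0 < P.rate i) {K : ℕ} (hK : P.threshold = K)
    (hs : Summable fun i : ℕ => ∏ j ∈ Finset.Icc 1 (i + 1), 1 / P.rate j) :
    ∑' i : ℕ, weight P ((K : ℤ) + 1 + i) =
      weight P K * ENNReal.ofReal (∑' i : ℕ, ∏ j ∈ Finset.Icc 1 (i + 1), 1 / P.rate j) := by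
  simp_rw [weight_above_threshold hP hK]
  rw [ENNReal.tsum_mul_left, ENNReal.ofReal_tsum_of_nonneg
    (fun i => Finset.prod_nonneg fun j _ => (one_div_pos.2 (hP j)).le) hs]

lemma sum_range_pow_succ {ρ : ℝ} (h : ρ < 1) (n : ℕ) :
    ∑ i ∈ Finset.range n, ρ ^ (i + 1) = (ρ - ρ ^ (n + 1)) / (1 - ρ) := by
  have h1 : 1 - ρ ≠ 0 := by linarith
  rw [eq_div_iff h1]
  induction n with
  | zero => simp
  | succ n ih =>
    rw [Finset.sum_range_succ, add_mul, ih]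
    ring

lemma hasSum_pow_succ {ρ : ℝ} (h0 : 0 ≤ ρ) (h : ρ < 1) :
    HasSum (fun i : ℕ => ρ ^ (i + 1)) (ρ / (1 - ρ)) := by
  simp_rw [pow_succ']
  rw [div_eq_mul_inv]
  exact (hasSum_geometric_of_lt_one h0 h).mul_left ρ

/-- `C` is the total weight above `m`, relative to that of `m`. -/
lemma tsum_weight_above (hP : P.Admissible μ Λ) {m : ℕ} (hm : (m : ℕ∞) < P.threshold) :
    ∑' i : ℕ, weight P ((m : ℤ) + 1 + i) = weight P m * ENNReal.ofReal (improveConst P m) := by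
  have h0 := hP.rate_pos' 0
  have hρ0 : 0 < 1 / P.rate 0 := by positivity
  have hρ1 : 1 / P.rate 0 < 1 := by
    rw [div_lt_one h0]
    exact hP.one_lt_rate_zero
  by_cases hT : P.threshold = ⊤
  · rw [improveConst, if_pos hT, ← (hasSum_pow_succ hρ0.le hρ1).tsum_eq,
      ENNReal.ofReal_tsum_of_nonneg (fun i => by positivity) (hasSum_pow_succ hρ0.le hρ1).summable,
      ← ENNReal.tsum_mul_left]
    congr 1
    funext i
    rw [← weight_add_of_le_threshold hP m (i + 1) (fun K hK => by simp [hT] at hK)]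
    congr 1
    push_cast
    ring
  · obtain ⟨K, hK⟩ := ENat.ne_top_iff_exists.1 hT
    have hK' : P.threshold = K := hK.symm
    have hmK : m < K := by
      rw [hK'] at hm
      exact_mod_cast hm
    have hG : 0 ≤ ∑' i : ℕ, ∏ j ∈ Finset.Icc 1 (i + 1), 1 / P.rate j :=
      tsum_nonneg fun i => Finset.prod_nonneg fun j _ => (one_div_pos.2 (hP.rate_pos' j)).le
    rw [improveConst, if_neg hT, hK', ENat.toNat_natCast]
    simp only
    rw [← sum_range_pow_succ hρ1, ENNReal.ofReal_add (Finset.sum_nonneg fun i _ => by positivity)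
      (by positivity), ENNReal.ofReal_sum_of_nonneg (fun i _ => by positivity),
      ENNReal.ofReal_mul (by positivity), mul_add, Finset.mul_sum, ← mul_assoc,
      ← weight_add_of_le_threshold hP m (K - m) (fun L hL => by
        rw [hK'] at hL
        have : K = L := by exact_mod_cast hL
        omega),
      ← Summable.sum_add_tsum_nat_add' (k := K - m) ENNReal.summable]
    congr 1
    · refine Finset.sum_congr rfl fun i hi => ?_
      rw [← weight_add_of_le_threshold hP m (i + 1) (fun L hL => by
        rw [hK'] at hL
        have : K = L := by exact_mod_cast hL
        have := Finset.mem_range.1 hi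
        omega)]
      congr 1
      push_cast
      ring
    · rw [show (m : ℤ) + ((K - m : ℕ) : ℤ) = K by omega,
        ← tsum_weight_above_threshold hP.rate_pos' hK' hP.summable]
      congr 1
      funext i
      congr 1
      push_cast
      omega

/-- `C` is a series of products of inverse rates, each at least `1/Λ`, hence at least the geometric
series in `1/Λ`. This is what gives `τ₁ ≤ Λ`. -/
lemma inv_max_le_improveConst (hP : P.Admissible μ Λ) {m : ℕ} :
    1 / Λ / (1 - 1 / Λ) ≤ improveConst P m := by
  have h0 := hP.rate_pos' 0
  have hΛ := hP.one_lt_max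
  have hΛ0 : 0 < Λ := by linarith
  have hρ0 : 0 < 1 / P.rate 0 := by positivity
  have hρ1 : 1 / P.rate 0 < 1 := by
    rw [div_lt_one h0]
    exact hP.one_lt_rate_zero
  have hr0 : 0 < 1 / Λ := by positivity
  have hr1 : 1 / Λ < 1 := by rwa [div_lt_one hΛ0]
  have hle : ∀ i, 1 / Λ ≤ 1 / P.rate i :=
    fun i => one_div_le_one_div_of_le (hP.rate_pos' i) (hP.rate_le i)
  have hr := hasSum_pow_succ hr0.le hr1
  unfold improveConst
  simp only
  split_ifs with hT
  · rw [← hr.tsum_eq, ← (hasSum_pow_succ hρ0.le hρ1).tsum_eq]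
    refine hr.summable.tsum_le_tsum (fun i => ?_) (hasSum_pow_succ hρ0.le hρ1).summable
    gcongr
    exact hP.rate_le 0
  · set n := P.threshold.toNat - m
    have hG : 1 / Λ / (1 - 1 / Λ) ≤ ∑' i : ℕ, ∏ j ∈ Finset.Icc 1 (i + 1), 1 / P.rate j := by
      rw [← hr.tsum_eq]
      refine hr.summable.tsum_le_tsum (fun i => ?_) hP.summable
      calc (1 / Λ) ^ (i + 1) = ∏ j ∈ Finset.Icc 1 (i + 1), 1 / Λ := by simp
        _ ≤ _ := Finset.prod_le_prod (fun _ _ => hr0.le) fun j _ => hle j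
    -- The geometric series is split after `n = M - m` terms, to match the two summands of `C`.
    calc 1 / Λ / (1 - 1 / Λ)
        = ∑ i ∈ Finset.range n, (1 / Λ) ^ (i + 1) + (1 / Λ) ^ n * (1 / Λ / (1 - 1 / Λ)) := by
          rw [sum_range_pow_succ hr1, ← mul_div_assoc, ← add_div]
          ring
      _ ≤ ∑ i ∈ Finset.range n, (1 / P.rate 0) ^ (i + 1) +
          (1 / P.rate 0) ^ n * ∑' i : ℕ, ∏ j ∈ Finset.Icc 1 (i + 1), 1 / P.rate j := by
          have hh : 0 ≤ 1 / Λ / (1 - 1 / Λ) := div_nonneg hr0.le (by linarith)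
          refine add_le_add (Finset.sum_le_sum fun i _ => ?_) ?_
          · exact pow_le_pow_left₀ hr0.le (hle 0) _
          · exact mul_le_mul (pow_le_pow_left₀ hr0.le (hle 0) _) hG hh (by positivity)
      _ = _ := by rw [sum_range_pow_succ hρ1]

lemma improveConst_pos (hP : P.Admissible μ Λ) (m : ℕ) : 0 < improveConst P m := by
  have hΛ := hP.one_lt_max
  have hr1 : 1 / Λ < 1 := by rwa [div_lt_one (by linarith)]
  exact (div_pos (by positivity) (by linarith)).trans_le (inv_max_le_improveConst hP)

lemma prod_improve_rate (Λ : ℝ) (P : Policy) (m i : ℕ) :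
    ∏ j ∈ Finset.Icc 1 (i + 1), 1 / (improve Λ P m).rate j =
      (1 - 1 / Λ) * improveConst P m * (1 / Λ) ^ i := by
  induction i with
  | zero => simp [improve]
  | succ i ih =>
    rw [Finset.prod_Icc_succ_top (by omega), ih, pow_succ, mul_assoc (_ * _)]
    congr 2

/-- The factor `1 - 1/Λ` in `τ₁` compensates the geometric series in `1/Λ` of the later rates, so
that the sum is exactly `C`. -/
lemma hasSum_improve_rate (hP : P.Admissible μ Λ) (m : ℕ) :
    HasSum (fun i : ℕ => ∏ j ∈ Finset.Icc 1 (i + 1), 1 / (improve Λ P m).rate j)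
      (improveConst P m) := by
  have hΛ := hP.one_lt_max
  have hr1 : 1 / Λ < 1 := by rwa [div_lt_one (by linarith)]
  simp_rw [prod_improve_rate]
  have h := (hasSum_geometric_of_lt_one (r := 1 / Λ) (by positivity) hr1).mul_left
    ((1 - 1 / Λ) * improveConst P m)
  have hne : 1 - 1 / Λ ≠ 0 := by linarith
  rwa [mul_right_comm, mul_inv_cancel₀ hne, one_mul] at h

lemma improve_admissible (hP : P.Admissible μ Λ) (m : ℕ) :
    (improve Λ P m).Admissible μ Λ := by
  have hΛ := hP.one_lt_max
  have hΛ0 : 0 < Λ := by linarith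
  have hC := improveConst_pos hP m
  have hr1 : 1 / Λ < 1 := by rwa [div_lt_one (by linarith)]
  have hr2 : 0 < 1 - 1 / Λ := by linarith
  refine ⟨hP.one_lt_prep, hΛ, hP.one_lt_rate_zero, fun i hi => ?_, fun i => ?_,
    (hasSum_improve_rate hP m).summable⟩
  · simp only [improve]
    rw [if_neg hi.ne']
    split_ifs
    · positivity
    · exact hΛ0
  · simp only [improve]
    split_ifs
    · exact hP.rate_le 0
    · rw [div_le_iff₀ (by positivity)]
      have := inv_max_le_improveConst hP (m := m)
      rw [div_le_iff₀ hr2, div_le_iff₀ hΛ0] at this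
      linarith
    · exact le_rfl

lemma weightNat_improve {m : ℕ} (hm : (m : ℕ∞) < P.threshold) {n : ℕ}
    (hn : n ≤ P.buffer + m) : weightNat (improve Λ P m) n = weightNat P n := by
  refine Finset.prod_congr rfl fun i hi => ?_
  have hi' := Finset.mem_range.1 hi
  have h1 : signal P.threshold ((i : ℤ) + 1 - P.buffer) = 0 := by
    refine signal_eq_zero fun K hK => ?_
    rw [hK] at hm
    have : m < K := by exact_mod_cast hm
    omega
  have h2 : signal (improve Λ P m).threshold ((i : ℤ) + 1 - (improve Λ P m).buffer) = 0 := by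
    change signal (m : ℕ∞) ((i : ℤ) + 1 - P.buffer) = 0
    rw [signal_natCast]
    omega
  rw [h1, h2]
  rfl

lemma weight_improve {m : ℕ} (hm : (m : ℕ∞) < P.threshold) :
    weight (improve Λ P m) m = weight P m := by
  have h := weightNat_improve (Λ := Λ) hm (n := P.buffer + m) le_rfl
  rw [← weight_sub_buffer, ← weight_sub_buffer] at h
  have e : ((P.buffer + m : ℕ) : ℤ) - P.buffer = m := by push_cast; ring
  have e' : ((P.buffer + m : ℕ) : ℤ) - (improve Λ P m).buffer = m := e
  rwa [e, e'] at h

lemma tsum_weight_above_improve (hP : P.Admissible μ Λ) {m : ℕ} (hm : (m : ℕ∞) < P.threshold) :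
    ∑' i : ℕ, weight (improve Λ P m) ((m : ℤ) + 1 + i) =
      ∑' i : ℕ, weight P ((m : ℤ) + 1 + i) := by
  rw [tsum_weight_above hP hm, tsum_weight_above_threshold (K := m)
    (improve_admissible hP m).rate_pos' rfl (hasSum_improve_rate hP m).summable,
    (hasSum_improve_rate hP m).tsum_eq, weight_improve hm]

lemma tsum_weight_mul_improve {m : ℕ} (hm : (m : ℕ∞) < P.threshold) (g : ℤ → ℝ≥0∞) :
    ∑' q, weight (improve Λ P m) q * g q =
      ∑ n ∈ Finset.range (P.buffer + m + 1), weightNat P n * g ((n : ℤ) - P.buffer) +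
        ∑' i : ℕ, weight (improve Λ P m) ((m : ℤ) + 1 + i) * g ((m : ℤ) + 1 + i) := by
  rw [tsum_weight_mul _ m]
  congr 1
  refine Finset.sum_congr rfl fun n hn => ?_
  rw [weightNat_improve hm (Nat.lt_succ_iff.1 (Finset.mem_range.1 hn))]
  rfl

lemma tsum_weight_improve (hP : P.Admissible μ Λ) {m : ℕ} (hm : (m : ℕ∞) < P.threshold) :
    ∑' q, weight (improve Λ P m) q = ∑' q, weight P q := by
  have h1 := tsum_weight_mul P m fun _ => 1
  have h2 := tsum_weight_mul_improve (Λ := Λ) hm fun _ => 1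
  simp only [mul_one] at h1 h2
  rw [h1, h2, tsum_weight_above_improve hP hm]

lemma weightNat_ne_top (hP : P.Admissible μ Λ) (n : ℕ) : weightNat P n ≠ ∞ :=
  weight_sub_buffer (P := P) n ▸ weight_ne_top hP _

lemma tsum_weight_ne_top (hP : P.Admissible μ Λ) {m : ℕ} (hm : (m : ℕ∞) < P.threshold) :
    ∑' q, weight P q ≠ ∞ := by
  have h1 := tsum_weight_mul P m fun _ => 1
  simp only [mul_one] at h1
  rw [h1, tsum_weight_above hP hm]
  exact ENNReal.add_ne_top.2 ⟨ENNReal.sum_ne_top.2 fun n _ => weightNat_ne_top hP n,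
    ENNReal.mul_ne_top (weight_ne_top hP _) ENNReal.ofReal_ne_top⟩

/-- The bound `λᵢ ≤ Λ` enters the comparison of tails here; `weight_improve_succ` is the case of
equality. -/
lemma weight_mul_inv_max_le (hP : P.Admissible μ Λ) (m i : ℕ) :
    weight P ((m : ℤ) + 1 + i) * (ENNReal.ofReal Λ)⁻¹ ≤
      weight P ((m : ℤ) + 1 + ((i + 1 : ℕ) : ℤ)) := by
  push_cast
  rw [← add_assoc, weight_add_one (q := (m : ℤ) + 1 + i) (by omega)]
  gcongr
  exact hP.rate_le _

lemma weight_improve_succ (Λ : ℝ) (P : Policy) (m i : ℕ) :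
    weight (improve Λ P m) ((m : ℤ) + 1 + ((i + 1 : ℕ) : ℤ)) =
      weight (improve Λ P m) ((m : ℤ) + 1 + i) * (ENNReal.ofReal Λ)⁻¹ := by
  push_cast
  rw [← add_assoc, weight_add_one (q := (m : ℤ) + 1 + i) (by omega)]
  have : signal (improve Λ P m).threshold ((m : ℤ) + 1 + i + 1) = i + 2 := by
    change signal (m : ℕ∞) _ = _
    rw [signal_natCast]
    omega
  rw [this]
  congr 3

/-- The tail part of the mean of `Q₂⁺`. -/
lemma tsum_tail_mul_toNat (w : ℤ → ℝ≥0∞) (m : ℕ) :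
    ∑' i : ℕ, w ((m : ℤ) + 1 + i) * (((m : ℤ) + 1 + i).toNat : ℝ≥0∞) =
      (∑' i : ℕ, w ((m : ℤ) + 1 + i)) * m +
        ∑' i : ℕ, w ((m : ℤ) + 1 + i) * ((i : ℝ≥0∞) + 1) := by
  rw [← ENNReal.tsum_mul_right, ← ENNReal.tsum_add]
  congr 1
  funext i
  rw [show ((m : ℤ) + 1 + i).toNat = m + (i + 1) by omega]
  push_cast
  ring

/-! ### Comparison of the stationary means -/

lemma inv_ofReal_lt_one {t : ℝ} (ht : 1 < t) : (ENNReal.ofReal t)⁻¹ < 1 := by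
  rw [ENNReal.inv_lt_one, ← ENNReal.ofReal_one]
  exact (ENNReal.ofReal_lt_ofReal_iff (by linarith)).2 ht

lemma tsum_stationary_mul_queues (μ : ℝ) (P : Policy) :
    ∑' x : ℕ × ℤ, stationary μ P x * ((x.1 : ℝ≥0∞) + (x.2.toNat : ℝ≥0∞)) =
      (∑' a : ℕ, (ENNReal.ofReal μ)⁻¹ ^ a * a) * ∑' q, weight P q +
        (∑' a : ℕ, (ENNReal.ofReal μ)⁻¹ ^ a) * ∑' q, weight P q * (q.toNat : ℝ≥0∞) := by
  have h1 := tsum_stationary_mul (μ := μ) (P := P) (fun a => (a : ℝ≥0∞)) fun _ => 1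
  have h2 := tsum_stationary_mul (μ := μ) (P := P) (fun _ => 1) fun q => (q.toNat : ℝ≥0∞)
  simp only [mul_one, one_mul] at h1 h2
  rw [← h1, ← h2, ← ENNReal.tsum_add]
  simp_rw [mul_add]

lemma tsum_stationary (μ : ℝ) (P : Policy) :
    ∑' x, stationary μ P x = (∑' a : ℕ, (ENNReal.ofReal μ)⁻¹ ^ a) * ∑' q, weight P q := by
  have h := tsum_stationary_mul (μ := μ) (P := P) (fun _ => 1) fun _ => 1
  simpa only [mul_one] using h

lemma tsum_pow_mul_ne_top (hμ : 1 < μ) : ∑' a : ℕ, (ENNReal.ofReal μ)⁻¹ ^ a * a ≠ ∞ := by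
  refine ne_top_of_le_ne_top (tsum_mul_succ_ne_top (v := fun a => (ENNReal.ofReal μ)⁻¹ ^ a)
    (inv_ofReal_lt_one hμ) (by simp) fun i => pow_succ _ _) (ENNReal.tsum_le_tsum fun a => ?_)
  gcongr
  exact le_self_add

/-- Only states with waiting riders contribute to the numerator; they lie below `m`, where the
weights coincide. -/
lemma mean_rider_improve (hP : P.Admissible μ Λ) {m : ℕ} (hm : (m : ℕ∞) < P.threshold) :
    (∑' x : ℕ × ℤ, stationary μ (improve Λ P m) x * ((-x.2).toNat : ℝ≥0∞)) /
        ∑' x, stationary μ (improve Λ P m) x =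
      (∑' x : ℕ × ℤ, stationary μ P x * ((-x.2).toNat : ℝ≥0∞)) / ∑' x, stationary μ P x := by
  have h : ∀ Q : Policy, ∑' x : ℕ × ℤ, stationary μ Q x * ((-x.2).toNat : ℝ≥0∞) =
      (∑' a : ℕ, (ENNReal.ofReal μ)⁻¹ ^ a) * ∑' q, weight Q q * ((-q).toNat : ℝ≥0∞) := fun Q => by
    have h := tsum_stationary_mul (μ := μ) (P := Q) (fun _ => 1) fun q => ((-q).toNat : ℝ≥0∞)
    simpa only [mul_one, one_mul] using h
  have hz : ∀ i : ℕ, (-((m : ℤ) + 1 + i)).toNat = 0 := fun i => by omega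
  rw [h, h, tsum_stationary, tsum_stationary, tsum_weight_improve hP hm,
    tsum_weight_mul_improve hm, tsum_weight_mul P m]
  simp only [hz, Nat.cast_zero, mul_zero, tsum_zero]

lemma tail_mean_improve_ne_top (hP : P.Admissible μ Λ) (m : ℕ) :
    ∑' i : ℕ, weight (improve Λ P m) ((m : ℤ) + 1 + i) * ((i : ℝ≥0∞) + 1) ≠ ∞ :=
  tsum_mul_succ_ne_top (v := fun i : ℕ => weight (improve Λ P m) ((m : ℤ) + 1 + i))
    (inv_ofReal_lt_one hP.one_lt_max) (weight_ne_top (improve_admissible hP m) _)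
    (weight_improve_succ Λ P m)

lemma mean_prepared_improve_le (hP : P.Admissible μ Λ) {m : ℕ} (hm : (m : ℕ∞) < P.threshold) :
    ∑' q, weight (improve Λ P m) q * (q.toNat : ℝ≥0∞) ≤ ∑' q, weight P q * (q.toNat : ℝ≥0∞) := by
  rw [tsum_weight_mul_improve hm, tsum_weight_mul P m, tsum_tail_mul_toNat, tsum_tail_mul_toNat,
    tsum_weight_above_improve hP hm]
  gcongr _ + (_ + ?_)
  exact tsum_mul_succ_le (v := fun i : ℕ => weight P ((m : ℤ) + 1 + i))
    (v' := fun i : ℕ => weight (improve Λ P m) ((m : ℤ) + 1 + i))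
    (weight_mul_inv_max_le hP m) (weight_improve_succ Λ P m) (tsum_weight_above_improve hP hm)

lemma head_mean_ne_top (hP : P.Admissible μ Λ) (m : ℕ) :
    ∑ n ∈ Finset.range (P.buffer + m + 1),
      weightNat P n * ((((n : ℤ) - P.buffer).toNat : ℕ) : ℝ≥0∞) ≠ ∞ :=
  ENNReal.sum_ne_top.2 fun n _ =>
    ENNReal.mul_ne_top (weightNat_ne_top hP n) (ENNReal.natCast_ne_top _)

lemma tail_mul_ne_top (hP : P.Admissible μ Λ) {m : ℕ} (hm : (m : ℕ∞) < P.threshold) :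
    (∑' i : ℕ, weight P ((m : ℤ) + 1 + i)) * (m : ℝ≥0∞) ≠ ∞ := by
  rw [tsum_weight_above hP hm]
  exact ENNReal.mul_ne_top (ENNReal.mul_ne_top (weight_ne_top hP _) ENNReal.ofReal_ne_top)
    (ENNReal.natCast_ne_top _)

lemma rate_zero_eq_of_mean_eq (hP : P.Admissible μ Λ) {m : ℕ} (hm : (m : ℕ∞) < P.threshold)
    (h : ∑' q, weight (improve Λ P m) q * (q.toNat : ℝ≥0∞) =
      ∑' q, weight P q * (q.toNat : ℝ≥0∞)) :
    1 / P.rate 0 = (Λ - 1) / Λ * improveConst P m := by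
  rw [tsum_weight_mul_improve hm, tsum_weight_mul P m, tsum_tail_mul_toNat, tsum_tail_mul_toNat,
    tsum_weight_above_improve hP hm, ENNReal.add_right_inj (head_mean_ne_top hP m),
    ENNReal.add_right_inj (tail_mul_ne_top hP hm)] at h
  have h0 := zero_eq_of_tsum_mul_succ_eq (v := fun i : ℕ => weight P ((m : ℤ) + 1 + i))
    (v' := fun i : ℕ => weight (improve Λ P m) ((m : ℤ) + 1 + i))
    (weight_mul_inv_max_le hP m) (weight_improve_succ Λ P m) (tsum_weight_above_improve hP hm)
    (tail_mean_improve_ne_top hP m) h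
  have hs1 : signal P.threshold ((m : ℤ) + 1) = 0 := by
    refine signal_eq_zero fun K hK => ?_
    rw [hK] at hm
    have : m < K := by exact_mod_cast hm
    omega
  have hs2 : signal (improve Λ P m).threshold ((m : ℤ) + 1) = 1 := by
    change signal (m : ℕ∞) _ = _
    rw [signal_natCast]
    omega
  -- The value `m + 1` has signal `0` under the original policy, as `m < M`, and signal `1` under
  -- the new one. Equal weights of `m + 1` thus mean `τ₁ = λ₀`.
  simp only [Nat.cast_zero, add_zero] at h0
  rw [weight_add_one (q := (m : ℤ)) (by omega), weight_add_one (q := (m : ℤ)) (by omega),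
    weight_improve hm, hs1, hs2, ENNReal.mul_right_inj (weight_ne_zero (by omega))
    (weight_ne_top hP _), inv_inj, ENNReal.ofReal_eq_ofReal_iff
    ((improve_admissible hP m).rate_pos' 1).le (hP.rate_pos' 0).le] at h0
  rw [← h0]
  have hΛ : Λ ≠ 0 := (one_pos.trans hP.one_lt_max).ne'
  simp only [improve, one_ne_zero, if_false, if_true, one_div_one_div]
  rw [sub_div, div_self hΛ]

end MealDelivery
end

/-! ### The main theorem -/

open MealDelivery
theorem mainTheorem2 (μ Λ : ℝ) (P : Policy) (hP : P.Admissible μ Λ)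
    (m : ℕ) (hm : (m : ℕ∞) < P.threshold) :
    (improve Λ P m).Admissible μ Λ ∧
    ∃ To Tr To' Tr' : ℝ≥0∞,
      IsMeanOrderWait μ P To ∧ IsMeanRiderWait μ P Tr ∧
      IsMeanOrderWait μ (improve Λ P m) To' ∧ IsMeanRiderWait μ (improve Λ P m) Tr' ∧
      To' ≤ To ∧ Tr' = Tr ∧
      (To' = To → 1 / P.rate 0 = (Λ - 1) / Λ * improveConst P m) := by
  have hP' := improve_admissible hP m
  have hw := tsum_weight_ne_top hP hm
  have hw' : ∑' q, weight (improve Λ P m) q ≠ ∞ := tsum_weight_improve hP hm ▸ hw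
  refine ⟨hP', _, _, _, _, isMeanOrderWait hP hw, isMeanRiderWait hP hw, isMeanOrderWait hP' hw',
    isMeanRiderWait hP' hw', ?_, mean_rider_improve hP hm, fun h => ?_⟩
  · rw [tsum_stationary_mul_queues, tsum_stationary_mul_queues, tsum_stationary, tsum_stationary,
      tsum_weight_improve hP hm]
    gcongr (_ + _ * ?_) / _
    exact mean_prepared_improve_le hP hm
  · refine rate_zero_eq_of_mean_eq hP hm ?_
    have hA0 : ∑' a : ℕ, (ENNReal.ofReal μ)⁻¹ ^ a ≠ 0 := fun h => by
      simpa using ENNReal.tsum_eq_zero.1 h 0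
    have hA1 := tsum_inv_pow_ne_top hP.one_lt_prep
    have hW0 : ∑' q, weight P q ≠ 0 := fun h =>
      weight_ne_zero (P := P) (q := 0) (by omega) (ENNReal.tsum_eq_zero.1 h 0)
    have hD0 := mul_ne_zero hA0 hW0
    have hD1 := ENNReal.mul_ne_top hA1 hw
    rw [tsum_stationary_mul_queues, tsum_stationary_mul_queues, tsum_stationary, tsum_stationary,
      tsum_weight_improve hP hm] at h
    -- The common normalization is cleared; then the common contribution of `Q₁`, which is finite,
    -- and the geometric factor in `μ` cancel, which leaves the means of `Q₂⁺`.
    replace h := congrArg (· * ((∑' a : ℕ, (ENNReal.ofReal μ)⁻¹ ^ a) * ∑' q, weight P q)) h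
    simp only [ENNReal.div_mul_cancel hD0 hD1] at h
    rw [ENNReal.add_right_inj (ENNReal.mul_ne_top (tsum_pow_mul_ne_top hP.one_lt_prep) hw),
      ENNReal.mul_right_inj hA0 hA1] at h
    exact h
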